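/- **Setting.** Let $SU(2)=\{g\in\mathbb C^{2\times2}:\bar g^Tg=1,\ \det g=1\}$, with elements $h(\alpha,\beta)=\begin{pmatrix}\alpha&-\bar\beta\\ \beta&\bar\alpha\end{pmatrix}$, carry the volume of the round three-sphere of radius $2$ (the bi-invariant measure of total mass $16\pi^2$). For $\ell\in\frac12\mathbb N$ and $m,s\in\{-\ell,-\ell+1,\dots,\ell\}$ put $\psi^\ell_m(z_0,z_1)=\binom{2\ell}{\ell+m}^{1/2}z_0^{\ell+m}z_1^{\ell-m}$, let the Wigner functions $D^\ell_{m,s}\colon SU(2)\to\mathbb C$ be defined by $\sum_m\psi^\ell_m(z)D^\ell_{m,s}(h)=\psi^\ell_s(h^{-1}z)$, $z\in\mathbb C^2$, and put $\phi^\ell_{m,s}=\frac{\sqrt{2\ell+1}}{4\pi}D^\ell_{m,s}$. A *square integrable random field* is a jointly measurable random function $X\colon\Omega\times SU(2)\to\mathbb C$ on a probability space with $X\in L^2(SU(2))$ almost surely. For such $X$ let $$a^\ell_{m,s}=\int_{SU(2)}\overline{\phi^\ell_{m,s}}\,X,\qquad X^\ell_{\bullet,s}=\sum_{m=-\ell}^{\ell}a^\ell_{m,s}\phi^\ell_{m,s},\qquad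 X^\ell=\sum_{s=-\ell}^{\ell}X^\ell_{\bullet,s},$$ and let $\mathbb E\,\mathrm{RS}_X$ be the measure on $\frac12\mathbb Z$ with $\mathbb E\,\mathrm{RS}_X(\{s\})=\sum_{\ell}\mathbb E\{\|X^\ell_{\bullet,s}\|^2/\|X\|^2\}$ (norms of $L^2(SU(2))$; the sum is over those $\ell$ with $s\in\{-\ell,\dots,\ell\}$). $X$ is *left-invariant* if, for every $g\in SU(2)$, $X(g^{-1}\,\cdot)$ and $X$ have the same law as random elements of $L^2(SU(2))$; it is *pointwise left-invariant* if they have the same finite-dimensional distributions. A family of fields $(Y_i)_{i}$ is *jointly left-invariant* if for every $g$ the families $(Y_i(g^{-1}z))_{i,z}$ and $(Y_i(z))_{i,z}$ have the same finite-dimensional distributions. Two complex random fields $Y,Z$ are *uncorrelated* if for all $g,h$ both $\mathbb E[\overline{(Y(g)-\mathbb EY(g))}(Z(h)-\mathbb EZ(h))]$ and $\mathbb E[(Y(g)-\mathbb EY(g))(Z(h)-\mathbb EZ(h))]$ vanish. **Theorem.** Let $X$ be a square integrable random field on $SU(2)$. 1. $X$ is left-invariant if and only if the fields $X^\ell_{\bullet,s}$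 ($\ell\in\frac12\mathbb N$, $s\in\{-\ell,\dots,\ell\}$) are jointly left-invariant. Moreover, if $X$ is pointwise left-invariant, then the fields $X^\ell_{\bullet,s}$ are jointly left-invariant; the converse holds if $X$ is continuous in probability. 2. Suppose that $X$ is left-invariant. The following holds for all $(\ell,s)$ and $(\ell',s')$ with $\mathbb E\|X^\ell_{\bullet,s}\|^2<\infty$ and $\mathbb E\|X^{\ell'}_{\bullet,s'}\|^2<\infty$, and all $m,m'$. * If $\ell\ne0$, then $\mathbb E\{a^\ell_{m,s}\}=0$. Moreover $\mathbb E|a^\ell_{m,s}|^2=\frac1{2\ell+1}\mathbb E\|X^\ell_{\bullet,s}\|^2$ (independently of $m$). * If $\ell\neq\ell'$, then $\mathbb E\{\overline{a^\ell_{m,s}}a^{\ell'}_{m',s'}\}=\mathbb E\{a^\ell_{m,s}a^{\ell'}_{m',s'}\}=0$, and $X^\ell_{\bullet,s}$ and $X^{\ell'}_{\bullet,s'}$ are uncorrelated. * If $\ell=\ell'$, then $$\mathbb E\{\overline{a^\ell_{m,s}}\,a^\ell_{m',s'}\}=\frac{\delta_{m,m'}}{2\ell+1}\sum_{k=-\ell}^{\ell}\mathbb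 E\{\overline{a^\ell_{k,s}}\,a^\ell_{k,s'}\},\qquad \mathbb E\{a^\ell_{m,s}\,a^\ell_{m',s'}\}=\delta_{-m,m'}\frac{(-1)^{\ell-m}}{2\ell+1}\sum_{k=-\ell}^{\ell}(-1)^{\ell-k}\,\mathbb E\{a^\ell_{k,s}\,a^\ell_{-k,s'}\}.$$ 3. Components with the same $\ell$ can be correlated: for every $\ell\in\frac12\mathbb N$ and $s,s'\in\{-\ell,\dots,\ell\}$ there are a square integrable random field $Y$ with $Y=Y^\ell$ and $\mathbb E\|Y\|^2<\infty$, left-invariant and pointwise left-invariant, and points $g,h\in SU(2)$ such that $Y^\ell_{\bullet,s}(g)$ and $Y^\ell_{\bullet,s'}(h)$ have nonzero covariance. 4. For every $\ell\in\frac12\mathbb N$ and every probability measure $\nu$ on $\{-\ell,\dots,\ell\}$ there is a square integrable random field $Y$ with $Y=Y^\ell$ (i.e. of degree $2\ell$), left-invariant and pointwise left-invariant, such that $\mathbb E\,\mathrm{RS}_Y=\nu$. -/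

import Mathlib

open MeasureTheory ProbabilityTheory Filter Topology
open scoped ComplexConjugate ENNReal

namespace SpinField

noncomputable section

/-- The group `SU(2)`. Its elements are the matrices `h(α, β) = !![α, -conj β; β, conj α]` with
`|α|² + |β|² = 1`. -/
abbrev SU2 : Type := Matrix.specialUnitaryGroup (Fin 2) ℂ

instance : MeasurableSpace SU2 := borel SU2

instance : BorelSpace SU2 := ⟨rfl⟩

instance : IsTopologicalGroup SU2 where
  continuous_inv := by
    have h : Continuous fun g : SU2 => star (g : Matrix (Fin 2) (Fin 2) ℂ) :=
      continuous_star.comp continuous_subtype_val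
    exact h.subtype_mk _

instance : CompactSpace SU2 := by
  have hK : IsCompact {A : Matrix (Fin 2) (Fin 2) ℂ | ∀ i j, A i j ∈ Metric.closedBall 0 1} := by
    have := isCompact_pi_infinite (X := fun _ : Fin 2 => Fin 2 → ℂ)
      (s := fun _ => {v | ∀ j, v j ∈ Metric.closedBall (0 : ℂ) 1})
      fun _ => isCompact_pi_infinite fun _ => isCompact_closedBall (0 : ℂ) 1
    exact this
  have hc : IsClosed ((Matrix.specialUnitaryGroup (Fin 2) ℂ : Submonoid _) :
      Set (Matrix (Fin 2) (Fin 2) ℂ)) := by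
    have h1 : ((Matrix.specialUnitaryGroup (Fin 2) ℂ : Submonoid _) :
        Set (Matrix (Fin 2) (Fin 2) ℂ)) = {A | A * star A = 1} ∩ {A | A.det = 1} := by
      ext A
      simp [Matrix.mem_specialUnitaryGroup_iff, Matrix.mem_unitaryGroup_iff]
    rw [h1]
    exact (isClosed_eq (continuous_id.mul continuous_star) continuous_const).inter
      (isClosed_eq (Continuous.matrix_det continuous_id) continuous_const)
  refine isCompact_iff_compactSpace.mp (hK.of_isClosed_subset hc ?_)
  intro A hA i j
  simpa using entry_norm_bound_of_unitary (Matrix.mem_specialUnitaryGroup_iff.mp hA).1 i j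

/-- The Riemannian volume of `SU(2)` seen as the round three-sphere of radius `2`: the
bi-invariant measure of total mass `2 π² · 2³ = 16 π²`. -/
def vol : Measure SU2 :=
  ENNReal.ofReal (16 * Real.pi ^ 2) • Measure.haarMeasure (⊤ : TopologicalSpace.PositiveCompacts SU2)

/- Indexing. The half-integer `ℓ` is encoded by `n = 2ℓ : ℕ`, and an index
`m ∈ {-ℓ, -ℓ + 1, …, ℓ}` by `k = ℓ + m : Fin (n + 1)`. Thus `2ℓ + 1 = n + 1`,
`ℓ - m = n - k`, and `-m` is encoded by `k.rev`. -/

/-- The half-integer `s = k - ℓ ∈ {-ℓ, …, ℓ}` encoded by `k : Fin (n + 1)`, where `n = 2ℓ`. -/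
def spin (n : ℕ) (k : Fin (n + 1)) : ℚ := (k : ℚ) - (n : ℚ) / 2

/-- The monomial `ψ^ℓ_m(z₀, z₁) = C(2ℓ, ℓ+m)^{1/2} z₀^{ℓ+m} z₁^{ℓ-m}`. -/
def psi (n : ℕ) (m : Fin (n + 1)) (z₀ z₁ : ℂ) : ℂ :=
  (Real.sqrt (n.choose m) : ℂ) * z₀ ^ (m : ℕ) * z₁ ^ (n - m : ℕ)

/-- The Wigner function `D^ℓ_{m,s}`, i.e. the matrix coefficient determined by
`∑ₘ ψ^ℓ_m(z) D^ℓ_{m,s}(h) = ψ^ℓ_s(h⁻¹ z)`, where for `h = h(α, β)`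
`h⁻¹ (z₀, z₁) = (conj α z₀ + conj β z₁, -β z₀ + α z₁)`
(see `sum_psi_mul_wignerD`). It is the suitably normalized coefficient of `z₀^{ℓ+m} z₁^{ℓ-m}`
in `(conj α z₀ + conj β z₁)^{ℓ+s} (-β z₀ + α z₁)^{ℓ-s}`, written here with `z₁ = 1`. -/
def wignerD (n : ℕ) (m s : Fin (n + 1)) (h : SU2) : ℂ :=
  (Real.sqrt (n.choose s) / Real.sqrt (n.choose m) : ℂ) *
    ((Polynomial.C (conj (h.1 0 0)) * Polynomial.X + Polynomial.C (conj (h.1 1 0))) ^ (s : ℕ) *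
      (Polynomial.C (-(h.1 1 0)) * Polynomial.X + Polynomial.C (h.1 0 0)) ^ (n - s : ℕ)).coeff m

/-- The hyperspherical harmonic `φ^ℓ_{m,s} = (√(2ℓ+1) / 4π) D^ℓ_{m,s}`. -/
def phi (n : ℕ) (m s : Fin (n + 1)) (g : SU2) : ℂ :=
  (Real.sqrt (n + 1) / (4 * Real.pi) : ℂ) * wignerD n m s g

/-- The Fourier coefficient `a^ℓ_{m,s} = ⟨φ^ℓ_{m,s}, F⟩` in `L²(SU(2))`. -/
def coeff (n : ℕ) (m s : Fin (n + 1)) (F : SU2 → ℂ) : ℂ :=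
  ∫ g, conj (phi n m s g) * F g ∂vol

/-- The column component `F^ℓ_{•,s} = ∑ₘ a^ℓ_{m,s} φ^ℓ_{m,s}`. -/
def column (n : ℕ) (s : Fin (n + 1)) (F : SU2 → ℂ) (g : SU2) : ℂ :=
  ∑ m, coeff n m s F * phi n m s g

/-- The component `F^ℓ = ∑ₛ F^ℓ_{•,s}` of degree `2ℓ`. -/
def degreePart (n : ℕ) (F : SU2 → ℂ) (g : SU2) : ℂ :=
  ∑ s, column n s F g

/-- The Hilbert space `L²(SU(2))` with its Borel `σ`-algebra. -/
abbrev L2 : Type := Lp ℂ 2 vol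

instance : MeasurableSpace L2 := borel L2

instance : BorelSpace L2 := ⟨rfl⟩

open scoped Classical in
/-- The class in `L²(SU(2))` of a square integrable function. -/
def toL2 (F : SU2 → ℂ) : L2 :=
  if h : MemLp F 2 vol then h.toLp F else 0

section Fields

variable {Ω : Type*} [MeasurableSpace Ω]

/-- A square integrable random field on `SU(2)`: a (jointly measurable) random function that lies
in `L²(SU(2))` almost surely. -/
structure IsSquareIntegrableField (P : Measure Ω) (X : Ω → SU2 → ℂ) : Prop where
  measurable : Measurable (Function.uncurry X)
  memLp : ∀ᵐ ω ∂P, MemLp (X ω) 2 vol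

/-- `X(g⁻¹ ·)` and `X` have the same law, as random elements of `L²(SU(2))`, for every `g`. -/
def LeftInvariant (P : Measure Ω) (X : Ω → SU2 → ℂ) : Prop :=
  ∀ g : SU2, IdentDistrib (fun ω => toL2 fun z => X ω (g⁻¹ * z)) (fun ω => toL2 (X ω)) P P

/-- Joint left-invariance in law of a family of fields, pointwise: for every `g`, the families
`(Yᵢ(g⁻¹ z))_{i, z}` and `(Yᵢ(z))_{i, z}` of complex random variables have the same law (for the
product `σ`-algebra, i.e. the same finite-dimensional distributions). -/
def JointlyLeftInvariant {ι : Type*} (P : Measure Ω) (Y : ι → Ω → SU2 → ℂ) : Prop :=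
  ∀ g : SU2, IdentDistrib (fun ω (p : ι × SU2) => Y p.1 ω (g⁻¹ * p.2))
    (fun ω (p : ι × SU2) => Y p.1 ω p.2) P P

/-- Left-invariance of the finite-dimensional distributions of a single field. -/
def PointwiseLeftInvariant (P : Measure Ω) (X : Ω → SU2 → ℂ) : Prop :=
  JointlyLeftInvariant P fun _ : Unit => X

/-- Continuity in probability: `X(h) → X(g)` in probability as `h → g`. -/
def ContinuousInProbability (P : Measure Ω) (X : Ω → SU2 → ℂ) : Prop :=
  ∀ g : SU2, TendstoInMeasure P (fun h ω => X ω h) (𝓝 g) (fun ω => X ω g)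

/-- The family of all column components `X^ℓ_{•,s}`. -/
def columns (X : Ω → SU2 → ℂ) (i : Σ n : ℕ, Fin (n + 1)) (ω : Ω) : SU2 → ℂ :=
  column i.1 i.2 (X ω)

/-- The second moment `𝔼 ‖X‖²` of a random field, with the norm of `L²(SU(2))`. -/
def secondMoment (P : Measure Ω) (X : Ω → SU2 → ℂ) : ℝ≥0∞ :=
  ∫⁻ ω, eLpNorm (X ω) 2 vol ^ 2 ∂P

/-- The covariance `𝔼 [conj (U - 𝔼 U) (V - 𝔼 V)]` of two complex random variables. -/
def cov (P : Measure Ω) (U V : Ω → ℂ) : ℂ :=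
  ∫ ω, conj (U ω - ∫ ω', U ω' ∂P) * (V ω - ∫ ω', V ω' ∂P) ∂P

/-- Two complex random fields are uncorrelated: at all points, their values have zero covariance
and zero pseudo-covariance. -/
def Uncorrelated (P : Measure Ω) (Y Z : Ω → SU2 → ℂ) : Prop :=
  ∀ g h : SU2, cov P (fun ω => Y ω g) (fun ω => Z ω h) = 0 ∧
    cov P (fun ω => conj (Y ω g)) (fun ω => Z ω h) = 0

/-- The expected right spin `𝔼 RS_X`, as a measure on the half-integers (inside `ℚ`): its mass at
`s` is the sum over `ℓ` of `𝔼 (‖X^ℓ_{•,s}‖² / ‖X‖²)`. -/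
def expectedRightSpin (P : Measure Ω) (X : Ω → SU2 → ℂ) : Measure ℚ :=
  Measure.sum fun i : Σ n : ℕ, Fin (n + 1) =>
    (∫⁻ ω, eLpNorm (columns X i ω) 2 vol ^ 2 / eLpNorm (X ω) 2 vol ^ 2 ∂P) •
      Measure.dirac (spin i.1 i.2)

end Fields

/-- The defining identity of the Wigner functions, `∑ₘ ψ^ℓ_m(z) D^ℓ_{m,s}(h) = ψ^ℓ_s(h⁻¹ z)`. -/
theorem sum_psi_mul_wignerD (n : ℕ) (s : Fin (n + 1)) (h : SU2) (z₀ z₁ : ℂ) :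
    ∑ m, psi n m z₀ z₁ * wignerD n m s h =
      psi n s (conj (h.1 0 0) * z₀ + conj (h.1 1 0) * z₁) (-(h.1 1 0) * z₀ + h.1 0 0 * z₁) := by
  have key : (fun w : ℂ => ∑ m, psi n m z₀ w * wignerD n m s h) = fun w : ℂ =>
      psi n s (conj (h.1 0 0) * z₀ + conj (h.1 1 0) * w) (-(h.1 1 0) * z₀ + h.1 0 0 * w) := by
    refine Continuous.ext_on (dense_compl_singleton (0 : ℂ)) (by unfold psi; fun_prop)
      (by unfold psi; fun_prop) ?_
    intro w hw
    have hw0 : w ≠ 0 := hw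
    have hs : (s : ℕ) + (n - s : ℕ) = n := by omega
    set p : Polynomial ℂ :=
      (Polynomial.C (conj (h.1 0 0)) * Polynomial.X + Polynomial.C (conj (h.1 1 0))) ^ (s : ℕ) *
      (Polynomial.C (-(h.1 1 0)) * Polynomial.X + Polynomial.C (h.1 0 0)) ^ (n - s : ℕ) with hp
    have hdeg : p.natDegree < n + 1 := by
      refine Nat.lt_succ_of_le (Polynomial.natDegree_mul_le.trans ?_)
      refine (add_le_add
        (Polynomial.natDegree_pow_le_of_le _ Polynomial.natDegree_linear_le)
        (Polynomial.natDegree_pow_le_of_le _ Polynomial.natDegree_linear_le)).trans ?_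
      omega
    have hev : w ^ n * p.eval (z₀ / w) =
        (conj (h.1 0 0) * z₀ + conj (h.1 1 0) * w) ^ (s : ℕ) *
          (-(h.1 1 0) * z₀ + h.1 0 0 * w) ^ (n - s : ℕ) := by
      have e1 : conj (h.1 0 0) * z₀ + conj (h.1 1 0) * w =
          w * (conj (h.1 0 0) * (z₀ / w) + conj (h.1 1 0)) := by field_simp
      have e2 : -(h.1 1 0) * z₀ + h.1 0 0 * w =
          w * (-(h.1 1 0) * (z₀ / w) + h.1 0 0) := by field_simp
      rw [e1, e2, mul_pow, mul_pow, hp]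
      simp only [Polynomial.eval_mul, Polynomial.eval_pow, Polynomial.eval_add, Polynomial.eval_C,
        Polynomial.eval_X]
      nth_rewrite 1 [← hs]
      rw [pow_add]
      ring
    change ∑ m, psi n m z₀ w * wignerD n m s h = psi n s _ _
    rw [psi, mul_assoc, ← hev, Polynomial.eval_eq_sum_range' hdeg, Finset.sum_range,
      Finset.mul_sum, Finset.mul_sum]
    refine Finset.sum_congr rfl fun m _ => ?_
    have hm : (m : ℕ) + (n - m : ℕ) = n := by omega
    have hc : (Real.sqrt (n.choose m) : ℂ) ≠ 0 := by
      have : 0 < n.choose m := Nat.choose_pos (by omega)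
      exact_mod_cast (Real.sqrt_pos.mpr (by exact_mod_cast this)).ne'
    have hwm : w ^ n * (z₀ / w) ^ (m : ℕ) = z₀ ^ (m : ℕ) * w ^ (n - m : ℕ) := by
      nth_rewrite 1 [← hm]
      rw [pow_add, div_pow]
      field_simp
    rw [psi, wignerD, ← hp]
    calc _ = (Real.sqrt (n.choose s) : ℂ) * (p.coeff m * (z₀ ^ (m : ℕ) * w ^ (n - m : ℕ))) := by
          field_simp
      _ = _ := by rw [← hwm]; ring
  exact congrFun key z₁

end

end SpinField

open SpinField

namespace SpinField

noncomputable section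

/-! ### The group -/

/-! Left translation by `g` multiplies each vector of coefficients `(a_{m,s})_m` by the matrix `conj
D(g)`, with the column index `s` and the degree untouched (`coeff_translate`). Everything is
therefore reduced to one property, `CoeffInvariant`: the joint law of all Fourier coefficients is
unchanged by these matrices.

Equivalences. The harmonics form a Hilbert basis by Schur orthogonality and Stone-Weierstrass, so
the L² class of `X` and its coefficients determine each other. Columns are finite sums of
coefficients, and a coefficient is a finite combination of point values of its column
(`exists_finsupp_eval_column`). Pointwise invariance controls only finite-dimensional distributions,
whereas a coefficient is an integral; the integral is recovered by sampling at independent Haar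
points and the strong law (`tendsto_sampleCoeffs`). Conversely, Fourier partial sums converge to `X`
along a subsequence at almost every point, and a common right shift tending to `1`, together with
continuity in probability, reaches arbitrary points.

Correlations. For families `u`, `v` of random variables transforming by `D` and `conj D'`,
invariance of the law makes the matrix of expectations of `u_m v_{m'}` an intertwiner, so Schur's
lemma (`eq_zero_of_ne`, `eq_trace`) computes it. Covariances take `u = conj a`; pseudo-covariances
take `u_m = (-1)^{ℓ-m} a_{-m}`, which transforms correctly because the representation is self-dual
(`conj_wignerD`); means take `v = 1`.

Examples. A fixed combination of harmonics, rotated by a Haar random element and given a random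
sign, is invariant, and the norms of its columns are deterministic. Choosing the weights gives both
correlated columns and any prescribed expected right spin. -/

theorem SU2.apply_one_one (h : SU2) : h.1 1 1 = conj (h.1 0 0) := by
  have h1 := (Matrix.mem_specialUnitaryGroup_iff.mp h.2)
  have h2 : h.1⁻¹ = star h.1 := by
    apply Matrix.inv_eq_right_inv
    exact Matrix.mem_unitaryGroup_iff.mp h1.1
  rw [Matrix.inv_def, h1.2] at h2
  have := congrFun (congrFun h2 0) 0
  simpa [Matrix.adjugate_fin_two, Matrix.star_apply] using this

theorem SU2.apply_zero_one (h : SU2) : h.1 0 1 = -conj (h.1 1 0) := by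
  have h1 := (Matrix.mem_specialUnitaryGroup_iff.mp h.2)
  have h2 : h.1⁻¹ = star h.1 := by
    apply Matrix.inv_eq_right_inv
    exact Matrix.mem_unitaryGroup_iff.mp h1.1
  rw [Matrix.inv_def, h1.2] at h2
  have := congrFun (congrFun h2 0) 1
  have h3 : -h.1 0 1 = conj (h.1 1 0) := by
    simpa [Matrix.adjugate_fin_two, Matrix.star_apply] using this
  rw [← h3, neg_neg]

theorem SU2.conj_mul_add_conj_mul (h : SU2) :
    h.1 0 0 * conj (h.1 0 0) + h.1 1 0 * conj (h.1 1 0) = 1 := by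
  have h1 := (Matrix.mem_specialUnitaryGroup_iff.mp h.2).2
  rw [Matrix.det_fin_two, SU2.apply_one_one, SU2.apply_zero_one] at h1
  linear_combination h1

theorem SU2.mul_zero_zero (g h : SU2) :
    (g * h).1 0 0 = g.1 0 0 * h.1 0 0 - conj (g.1 1 0) * h.1 1 0 := by
  rw [show (g * h).1 = g.1 * h.1 from rfl, Matrix.mul_apply, Fin.sum_univ_two, SU2.apply_zero_one]
  ring

theorem SU2.mul_one_zero (g h : SU2) :
    (g * h).1 1 0 = g.1 1 0 * h.1 0 0 + conj (g.1 0 0) * h.1 1 0 := by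
  rw [show (g * h).1 = g.1 * h.1 from rfl, Matrix.mul_apply, Fin.sum_univ_two, SU2.apply_one_one]

theorem SU2.inv_zero_zero (h : SU2) : (h⁻¹).1 0 0 = conj (h.1 0 0) := rfl

theorem SU2.inv_one_zero (h : SU2) : (h⁻¹).1 1 0 = -(h.1 1 0) := by
  have : (h⁻¹).1 1 0 = conj (h.1 0 1) := rfl
  rw [this, SU2.apply_zero_one]
  simp

/-- The element `h(α, β)` of `SU(2)`. -/
def SU2.mk (α β : ℂ) (h : α * conj α + β * conj β = 1) : SU2 :=
  ⟨!![α, -conj β; β, conj α], by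
    rw [Matrix.mem_specialUnitaryGroup_iff, Matrix.mem_unitaryGroup_iff]
    constructor
    · ext i j
      fin_cases i <;> fin_cases j <;>
        simp [Matrix.mul_apply, Fin.sum_univ_two, Matrix.star_apply]
      · linear_combination h
      · ring
      · ring
      · linear_combination h
    · rw [Matrix.det_fin_two_of]
      linear_combination h⟩

/-! ### The Wigner functions -/

theorem sqrt_choose_ne_zero (n : ℕ) (m : Fin (n + 1)) : (Real.sqrt (n.choose m) : ℂ) ≠ 0 := by
  have : 0 < n.choose m := Nat.choose_pos (by omega)
  exact_mod_cast (Real.sqrt_pos.mpr (by exact_mod_cast this)).ne'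

/-- The monomials `psi n m` are linearly independent. -/
theorem psi_ext {n : ℕ} {c d : Fin (n + 1) → ℂ}
    (h : ∀ z₀ z₁, ∑ m, psi n m z₀ z₁ * c m = ∑ m, psi n m z₀ z₁ * d m) : c = d := by
  set p : Polynomial ℂ :=
    ∑ m : Fin (n + 1), Polynomial.monomial (m : ℕ) ((Real.sqrt (n.choose m) : ℂ) * (c m - d m))
    with hp
  have h0 : p = 0 := by
    refine Polynomial.funext fun z => ?_
    have := h z 1
    rw [hp, Polynomial.eval_finsetSum, Polynomial.eval_zero]
    rw [← sub_eq_zero, ← Finset.sum_sub_distrib] at this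
    rw [← this]
    refine Finset.sum_congr rfl fun m _ => ?_
    simp only [Polynomial.eval_monomial, psi, one_pow]
    ring
  funext m
  have h1 : p.coeff m = (Real.sqrt (n.choose m) : ℂ) * (c m - d m) := by
    rw [hp, Polynomial.finsetSum_coeff, Finset.sum_eq_single m]
    · simp
    · intro b _ hb
      rw [Polynomial.coeff_monomial, if_neg]
      exact fun h => hb (Fin.ext h)
    · simp
  rw [h0, Polynomial.coeff_zero, eq_comm, mul_eq_zero] at h1
  exact sub_eq_zero.mp (h1.resolve_left (sqrt_choose_ne_zero n m))

/-- Apply the generating identity twice, using `(gh)⁻¹ z = h⁻¹ (g⁻¹ z)`, and compare coefficients of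
the monomials. -/
theorem wignerD_mul (n : ℕ) (m s : Fin (n + 1)) (g h : SU2) :
    wignerD n m s (g * h) = ∑ k, wignerD n m k g * wignerD n k s h := by
  refine congrFun (psi_ext (c := fun m => wignerD n m s (g * h))
    (d := fun m => ∑ k, wignerD n m k g * wignerD n k s h) fun z₀ z₁ => ?_) m
  rw [sum_psi_mul_wignerD]
  simp_rw [Finset.mul_sum]
  rw [Finset.sum_comm]
  simp_rw [← mul_assoc, ← Finset.sum_mul, sum_psi_mul_wignerD]
  rw [SU2.mul_zero_zero, SU2.mul_one_zero]
  have h1 : conj (g.1 0 0 * h.1 0 0 - conj (g.1 1 0) * h.1 1 0) * z₀ +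
      conj (g.1 1 0 * h.1 0 0 + conj (g.1 0 0) * h.1 1 0) * z₁ =
      conj (h.1 0 0) * (conj (g.1 0 0) * z₀ + conj (g.1 1 0) * z₁) +
        conj (h.1 1 0) * (-(g.1 1 0) * z₀ + g.1 0 0 * z₁) := by
    simp only [map_add, map_sub, map_mul, Complex.conj_conj]; ring
  rw [h1]
  congr 1
  ring

theorem wignerD_one (n : ℕ) (m s : Fin (n + 1)) : wignerD n m s 1 = if m = s then 1 else 0 := by
  refine congrFun (psi_ext (c := fun m => wignerD n m s 1)
    (d := fun m => if m = s then 1 else 0) fun z₀ z₁ => ?_) m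
  rw [sum_psi_mul_wignerD]
  simp

theorem psi_rev (n : ℕ) (m : Fin (n + 1)) (x y : ℂ) : psi n m.rev x y = psi n m y x := by
  have h3 : n - (m.rev : ℕ) = m := by rw [Fin.val_rev]; omega
  have h4 : (m.rev : ℕ) = n - m := by rw [Fin.val_rev]; omega
  rw [psi, psi, h3, h4, Nat.choose_symm (by omega)]
  ring

theorem psi_neg_right (n : ℕ) (m : Fin (n + 1)) (x y : ℂ) :
    psi n m x (-y) = (-1) ^ (n - m : ℕ) * psi n m x y := by
  rw [psi, psi, neg_pow]
  ring

theorem conj_psi (n : ℕ) (m : Fin (n + 1)) (x y : ℂ) :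
    conj (psi n m x y) = psi n m (conj x) (conj y) := by
  simp [psi]

/-- Self-duality: the antilinear map `(z₀, z₁) ↦ (-conj z₁, conj z₀)` commutes with `SU(2)`, so the
conjugate representation is the original one with indices reversed, up to signs. The
pseudo-covariances rest on this. -/
theorem conj_wignerD (n : ℕ) (m s : Fin (n + 1)) (h : SU2) :
    conj (wignerD n m s h) =
      (-1) ^ (n - s : ℕ) * (-1) ^ (n - m : ℕ) * wignerD n m.rev s.rev h := by
  refine congrFun (psi_ext (c := fun m => conj (wignerD n m s h))
    (d := fun m => (-1) ^ (n - s : ℕ) * (-1) ^ (n - m : ℕ) * wignerD n m.rev s.rev h)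
    fun z₀ z₁ => ?_) m
  have h1 := congrArg conj (sum_psi_mul_wignerD n s h (conj z₀) (conj z₁))
  have h2 := sum_psi_mul_wignerD n s.rev h (-z₁) z₀
  have h3 : -(h.1 1 0) * -z₁ + h.1 0 0 * z₀ = h.1 0 0 * z₀ + h.1 1 0 * z₁ := by ring
  have h4 : conj (h.1 0 0) * -z₁ + conj (h.1 1 0) * z₀ =
    -(-conj (h.1 1 0) * z₀ + conj (h.1 0 0) * z₁) := by ring
  rw [← Equiv.sum_comp Fin.revPerm, psi_rev, h3, h4, psi_neg_right] at h2
  simp only [Fin.revPerm_apply, psi_rev, psi_neg_right] at h2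
  rw [map_sum, conj_psi] at h1
  simp only [map_mul, conj_psi, Complex.conj_conj, map_add, map_neg] at h1
  have h5 : ((-1 : ℂ) ^ (n - s : ℕ)) * (-1) ^ (n - s : ℕ) = 1 := by
    rw [← mul_pow]; simp
  rw [h1]
  refine ((one_mul _).symm.trans (congrArg (· * _) h5.symm)).trans ?_
  rw [mul_assoc, ← h2, Finset.mul_sum]
  refine Finset.sum_congr rfl fun m _ => ?_
  ring

/-! ### Explicit polynomial form of the Wigner functions -/

theorem coeff_linear_pow (a b : ℂ) (s i : ℕ) :
    ((Polynomial.C a * Polynomial.X + Polynomial.C b) ^ s).coeff i =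
      a ^ i * b ^ (s - i) * s.choose i := by
  have h : (Polynomial.C a * Polynomial.X + Polynomial.C b) ^ s =
      ∑ k ∈ Finset.range (s + 1), Polynomial.C (a ^ k * b ^ (s - k) * s.choose k) *
        Polynomial.X ^ k := by
    rw [add_pow]
    refine Finset.sum_congr rfl fun k _ => ?_
    simp only [map_mul, map_pow, map_natCast, mul_pow]
    ring
  rw [h, Polynomial.finsetSum_coeff]
  simp only [Polynomial.coeff_C_mul_X_pow]
  by_cases hi : i ∈ Finset.range (s + 1)
  · rw [Finset.sum_eq_single_of_mem i hi fun b _ hb => if_neg hb.symm, if_pos rfl]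
  · rw [Finset.sum_eq_zero fun k hk => if_neg (by rintro rfl; exact hi hk),
      Nat.choose_eq_zero_of_lt (by simpa using hi)]
    simp

/-- The Wigner functions as polynomials in the entries of `h⁻¹`. -/
theorem wignerD_eq_sum (n : ℕ) (m s : Fin (n + 1)) (h : SU2) :
    wignerD n m s h = (Real.sqrt (n.choose s) / Real.sqrt (n.choose m) : ℂ) *
      ∑ x ∈ Finset.HasAntidiagonal.antidiagonal (m : ℕ),
        (conj (h.1 0 0) ^ x.1 * conj (h.1 1 0) ^ (s - x.1 : ℕ) * (s : ℕ).choose x.1) *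
        ((-(h.1 1 0)) ^ x.2 * h.1 0 0 ^ (n - s - x.2 : ℕ) * (n - s : ℕ).choose x.2) := by
  rw [wignerD, Polynomial.coeff_mul]
  simp only [coeff_linear_pow]

theorem SU2.continuous_apply (i j : Fin 2) : Continuous fun h : SU2 => h.1 i j :=
  (continuous_subtype_val (p := fun A => A ∈ Matrix.specialUnitaryGroup (Fin 2) ℂ)).matrix_elem i j

theorem continuous_wignerD (n : ℕ) (m s : Fin (n + 1)) : Continuous (wignerD n m s) := by
  have h0 := SU2.continuous_apply 0 0
  have h1 := SU2.continuous_apply 1 0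
  have : wignerD n m s = _ := funext (wignerD_eq_sum n m s)
  rw [this]
  have h2 := Complex.continuous_conj.comp h0
  have h3 := Complex.continuous_conj.comp h1
  exact continuous_const.mul (continuous_finsetSum _ fun x _ =>
    (((h2.pow _).mul (h3.pow _)).mul continuous_const).mul
      (((h1.neg.pow _).mul (h0.pow _)).mul continuous_const))

/-- In the extreme column only one linear factor survives, so each entry is a single monomial in the
entries of `h`. This replaces irreducibility in Schur's lemma below. -/
theorem wignerD_last_ne_zero (n : ℕ) (m : Fin (n + 1)) (h : SU2) (h0 : h.1 0 0 ≠ 0)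
    (h1 : h.1 1 0 ≠ 0) : wignerD n m (Fin.last n) h ≠ 0 := by
  have hm : (n.choose m : ℂ) ≠ 0 := by
    exact_mod_cast (Nat.choose_pos (by omega : (m : ℕ) ≤ n)).ne'
  rw [wignerD, Fin.val_last, Nat.sub_self, pow_zero, mul_one, coeff_linear_pow]
  refine mul_ne_zero (div_ne_zero ?_ (sqrt_choose_ne_zero n m))
    (mul_ne_zero (mul_ne_zero (pow_ne_zero _ ?_) (pow_ne_zero _ ?_)) hm)
  · simp
  · simpa using h0
  · simpa using h1

/-- The binomial theorem; the square roots in `psi` are chosen for it, and it is the source of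
unitarity. -/
theorem sum_psi_mul_psi (n : ℕ) (x₀ x₁ y₀ y₁ : ℂ) :
    ∑ m, psi n m x₀ x₁ * psi n m y₀ y₁ = (x₀ * y₀ + x₁ * y₁) ^ n := by
  rw [add_pow, Finset.sum_range]
  refine Finset.sum_congr rfl fun m _ => ?_
  have h : (Real.sqrt (n.choose m) : ℂ) * (Real.sqrt (n.choose m) : ℂ) = n.choose m := by
    rw [← Complex.ofReal_mul, Real.mul_self_sqrt (by positivity)]
    simp
  rw [psi, psi, ← h]
  ring

/-- The Wigner matrices of inverse elements are conjugate transposes. -/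
theorem wignerD_inv (n : ℕ) (m s : Fin (n + 1)) (h : SU2) :
    wignerD n m s h⁻¹ = conj (wignerD n s m h) := by
  -- After pairing with `psi n s w₀ w₁`, both sides become `n`-th powers of bilinear pairings, and
  -- the claim reduces to `(h z) · w = z · (hᵀ w)`.
  have key : ∀ z₀ z₁ : ℂ, (fun s => ∑ m, psi n m z₀ z₁ * wignerD n m s h⁻¹) =
      fun s => ∑ m, psi n m z₀ z₁ * conj (wignerD n s m h) := by
    intro z₀ z₁
    refine psi_ext fun w₀ w₁ => ?_
    have h1 : ∀ m, ∑ s, psi n s w₀ w₁ * conj (wignerD n s m h) =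
        conj (∑ s, psi n s (conj w₀) (conj w₁) * wignerD n s m h) := by
      intro m
      simp [map_sum, conj_psi]
    simp_rw [sum_psi_mul_wignerD]
    rw [sum_psi_mul_psi]
    simp_rw [Finset.mul_sum]
    rw [Finset.sum_comm]
    simp_rw [mul_left_comm (psi n _ w₀ w₁), ← Finset.mul_sum]
    simp_rw [h1, sum_psi_mul_wignerD, conj_psi]
    rw [sum_psi_mul_psi, SU2.inv_zero_zero, SU2.inv_one_zero]
    congr 1
    simp only [map_add, map_mul, map_neg, Complex.conj_conj]
    ring
  exact congrFun (psi_ext (c := fun m => wignerD n m s h⁻¹)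
    (d := fun m => conj (wignerD n s m h)) fun z₀ z₁ => congrFun (key z₀ z₁) s) m

/-- The Wigner matrices are unitary. -/
theorem sum_conj_wignerD_mul (n : ℕ) (s s' : Fin (n + 1)) (h : SU2) :
    ∑ k, conj (wignerD n k s h) * wignerD n k s' h = if s = s' then 1 else 0 := by
  simp_rw [← wignerD_inv]
  rw [← wignerD_mul, inv_mul_cancel, wignerD_one]

/-! ### Schur's lemma for the Wigner matrices -/

/-- The monomials are weight vectors for the diagonal torus, with `α` acting by `α^{n - 2s}`. -/
theorem wignerD_torus (n : ℕ) (m s : Fin (n + 1)) (h : SU2) (h1 : h.1 1 0 = 0) :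
    wignerD n m s h = if m = s then conj (h.1 0 0) ^ (s : ℕ) * h.1 0 0 ^ (n - s : ℕ) else 0 := by
  refine congrFun (psi_ext (c := fun m => wignerD n m s h) (d := fun m => if m = s then
    conj (h.1 0 0) ^ (s : ℕ) * h.1 0 0 ^ (n - s : ℕ) else 0) fun z₀ z₁ => ?_) m
  rw [sum_psi_mul_wignerD, h1]
  simp [psi, mul_pow]
  ring

/-- `M` intertwines the Wigner representations of degrees `n` and `n'`. -/
def Intertwines (n n' : ℕ) (M : Fin (n + 1) → Fin (n' + 1) → ℂ) : Prop :=
  ∀ (g : SU2) (m : Fin (n + 1)) (m' : Fin (n' + 1)),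
    M m m' = ∑ k, ∑ k', wignerD n m k g * conj (wignerD n' m' k' g) * M k k'

namespace Intertwines

variable {n n' : ℕ} {M : Fin (n + 1) → Fin (n' + 1) → ℂ}

theorem conj_swap (hM : Intertwines n n' M) :
    Intertwines n' n fun m' m => conj (M m m') := by
  intro g m' m
  have h := congrArg conj (hM g m m')
  refine h.trans ?_
  simp only [map_sum]
  rw [Finset.sum_comm]
  refine Finset.sum_congr rfl fun k _ => ?_
  refine Finset.sum_congr rfl fun k' _ => ?_
  simp only [map_mul, Complex.conj_conj]
  ring

/-- The conjugation form `M = D M D'*` becomes the commutation form `M D' = D M` by unitarity of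
`D'`. -/
theorem sum_mul_wignerD (hM : Intertwines n n' M) (g : SU2) (m : Fin (n + 1))
    (j : Fin (n' + 1)) :
    ∑ k', M m k' * wignerD n' k' j g = ∑ k, wignerD n m k g * M k j := by
  have h : ∀ k', M m k' * wignerD n' k' j g = ∑ k, ∑ i, wignerD n m k g * M k i *
      (conj (wignerD n' k' i g) * wignerD n' k' j g) := by
    intro k'
    rw [hM g m k', Finset.sum_mul]
    refine Finset.sum_congr rfl fun k _ => ?_
    rw [Finset.sum_mul]
    refine Finset.sum_congr rfl fun i _ => ?_
    ring
  simp_rw [h]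
  rw [Finset.sum_comm]
  refine Finset.sum_congr rfl fun k _ => ?_
  rw [Finset.sum_comm]
  simp_rw [← Finset.mul_sum, sum_conj_wignerD_mul]
  simp

theorem eq_zero_of_weight_ne (hM : Intertwines n n' M) (m : Fin (n + 1)) (m' : Fin (n' + 1))
    (h : (n : ℤ) - 2 * m ≠ n' - 2 * m') : M m m' = 0 := by
  set k : ℤ := ((n : ℤ) - 2 * m) - (n' - 2 * m') with hk
  have hk0 : (k : ℂ) ≠ 0 := Int.cast_ne_zero.mpr (sub_ne_zero.mpr h)
  -- The torus element `t` scales this entry by `t ^ k`. The choice `t = exp(iπ/k)` makes the factor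
  -- `-1`, so the entry equals its own negative.
  set t : ℂ := Complex.exp (((Real.pi / k : ℝ) : ℂ) * Complex.I) with ht
  have htc : conj t = t⁻¹ := by
    rw [ht, ← Complex.exp_conj, ← Complex.exp_neg]
    simp
  have ht0 : t ≠ 0 := Complex.exp_ne_zero _
  have h1 := hM (SU2.mk t 0 (by rw [htc]; simp [ht0])) m m'
  simp only [wignerD_torus _ _ _ (SU2.mk t 0 _) rfl] at h1
  simp only [apply_ite conj, map_zero, ite_mul, zero_mul, mul_ite, mul_zero,
    Finset.sum_ite_eq, Finset.mem_univ, if_true] at h1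
  have e0 : (SU2.mk t 0 (by rw [htc]; simp [ht0])).1 0 0 = t := rfl
  rw [e0] at h1
  have e1 : conj t ^ (m : ℕ) * t ^ (n - m : ℕ) * conj (conj t ^ (m' : ℕ) * t ^ (n' - m' : ℕ)) =
      -1 := by
    simp only [map_mul, map_pow, Complex.conj_conj]
    rw [htc]
    have : t⁻¹ ^ (m : ℕ) * t ^ (n - m : ℕ) * (t ^ (m' : ℕ) * t⁻¹ ^ (n' - m' : ℕ)) = t ^ k := by
      rw [inv_pow, inv_pow, ← zpow_natCast, ← zpow_natCast, ← zpow_natCast, ← zpow_natCast,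
        ← zpow_neg, ← zpow_neg, ← zpow_add₀ ht0, ← zpow_add₀ ht0, ← zpow_add₀ ht0]
      congr 1
      omega
    rw [this, ht, ← Complex.exp_int_mul, ← Complex.exp_pi_mul_I]
    congr 1
    push_cast
    field_simp
  rw [e1] at h1
  have : (2 : ℂ) * M m m' = 0 := by linear_combination h1
  simpa using this

/-- Any element with both entries of its first column nonzero works, for all degrees at once; `3/5,
4/5` is such a column. -/
theorem exists_wignerD_ne_zero : ∃ g : SU2, ∀ (n : ℕ) (m : Fin (n + 1)),
    wignerD n m (Fin.last n) g ≠ 0 := by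
  have h : ((3 / 5 : ℝ) : ℂ) * conj ((3 / 5 : ℝ) : ℂ) +
      ((4 / 5 : ℝ) : ℂ) * conj ((4 / 5 : ℝ) : ℂ) = 1 := by
    simp only [Complex.conj_ofReal]
    norm_num
  refine ⟨SU2.mk _ _ h, fun n m => wignerD_last_ne_zero n m _ ?_ ?_⟩
  · change ((3 / 5 : ℝ) : ℂ) ≠ 0
    norm_num
  · change ((4 / 5 : ℝ) : ℂ) ≠ 0
    norm_num

/-- The extreme weight `-n` does not occur in the smaller representation, so the last row of `M`
vanishes. In the last row of `M D' = D M` only the entry of `M` with the weight of `j` survives,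
multiplied by a nonzero Wigner coefficient. -/
theorem eq_zero_of_lt (hM : Intertwines n n' M) (h : n' < n) (i : Fin (n + 1))
    (j : Fin (n' + 1)) : M i j = 0 := by
  by_cases hij : (n : ℤ) - 2 * i = n' - 2 * j
  swap
  · exact hM.eq_zero_of_weight_ne i j hij
  obtain ⟨g, hg⟩ := exists_wignerD_ne_zero
  -- Nonvanishing is known for the last column of `D(g)`; passing to `g⁻¹` turns it into the last
  -- row.
  have h1 := hM.sum_mul_wignerD g⁻¹ (Fin.last n) j
  rw [Finset.sum_eq_zero, Finset.sum_eq_single i] at h1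
  · rw [wignerD_inv, eq_comm, mul_eq_zero] at h1
    exact h1.resolve_left (by simpa using hg n i)
  · intro k _ hk
    rw [hM.eq_zero_of_weight_ne k j, mul_zero]
    intro h2
    exact hk (Fin.ext (by omega))
  · simp
  · intro k' _
    rw [hM.eq_zero_of_weight_ne, zero_mul]
    rw [Fin.val_last]
    omega

theorem eq_zero_of_ne (hM : Intertwines n n' M) (h : n ≠ n') (i : Fin (n + 1))
    (j : Fin (n' + 1)) : M i j = 0 := by
  rcases h.lt_or_gt with h | h
  · simpa using hM.conj_swap.eq_zero_of_lt h j i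
  · exact hM.eq_zero_of_lt h i j

/-- Weights within one degree are distinct, so `M` is diagonal. Commutation, read in the last column
at an element where that column has no zero, makes all diagonal entries equal, and the trace fixes
their common value. -/
theorem eq_trace {M : Fin (n + 1) → Fin (n + 1) → ℂ} (hM : Intertwines n n M)
    (i j : Fin (n + 1)) : M i j = (if j = i then 1 / (n + 1 : ℂ) else 0) * ∑ k, M k k := by
  have hd : ∀ i j, i ≠ j → M i j = 0 := fun i j h =>
    hM.eq_zero_of_weight_ne i j fun h' => h (Fin.ext (by omega))
  have hc : ∀ i, M i i = M (Fin.last n) (Fin.last n) := by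
    intro i
    obtain ⟨g, hg⟩ := exists_wignerD_ne_zero
    have h1 := hM.sum_mul_wignerD g i (Fin.last n)
    rw [Finset.sum_eq_single i (fun k _ hk => by rw [hd i k hk.symm, zero_mul]) (by simp),
      Finset.sum_eq_single (Fin.last n) (fun k _ hk => by rw [hd k _ hk, mul_zero]) (by simp),
      mul_comm] at h1
    exact mul_left_cancel₀ (hg n i) h1
  split_ifs with h
  · subst h
    have hn : (n + 1 : ℂ) ≠ 0 := by exact_mod_cast n.succ_ne_zero
    simp_rw [hc]
    simp
    field_simp
  · rw [hd i j (Ne.symm h), zero_mul]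

end Intertwines

/-! ### Haar measure on `SU(2)` -/

instance : IsFiniteMeasure vol := by unfold vol; exact Measure.smul_finite _ ENNReal.ofReal_ne_top
instance : vol.IsMulLeftInvariant := by unfold vol; infer_instance
instance : vol.IsOpenPosMeasure := by
  unfold vol
  exact Measure.isOpenPosMeasure_smul _ (by simp)
instance : SecondCountableTopology (Matrix (Fin 2) (Fin 2) ℂ) :=
  inferInstanceAs (SecondCountableTopology (Fin 2 → Fin 2 → ℂ))
instance : TopologicalSpace.MetrizableSpace (Matrix (Fin 2) (Fin 2) ℂ) :=
  inferInstanceAs (TopologicalSpace.MetrizableSpace (Fin 2 → Fin 2 → ℂ))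
instance : SecondCountableTopology SU2 :=
  TopologicalSpace.Subtype.secondCountableTopology _

theorem vol_real_univ : vol.real Set.univ = 16 * Real.pi ^ 2 := by
  have : Measure.haarMeasure (⊤ : TopologicalSpace.PositiveCompacts SU2) Set.univ = 1 :=
    Measure.haarMeasure_self (K₀ := ⊤)
  rw [Measure.real, vol, Measure.smul_apply, this, smul_eq_mul, mul_one, ENNReal.toReal_ofReal]
  positivity

/-! ### Hyperspherical harmonics -/

theorem continuous_phi (n : ℕ) (m s : Fin (n + 1)) : Continuous (phi n m s) :=
  continuous_const.mul (continuous_wignerD n m s)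

theorem memLp_of_continuous {f : SU2 → ℂ} (hf : Continuous f) (p : ℝ≥0∞) : MemLp f p vol :=
  hf.memLp_of_hasCompactSupport (HasCompactSupport.of_compactSpace f)

theorem phi_mul (n : ℕ) (m s : Fin (n + 1)) (g z : SU2) :
    phi n m s (g * z) = ∑ k, wignerD n m k g * phi n k s z := by
  simp only [phi, wignerD_mul, Finset.mul_sum]
  exact Finset.sum_congr rfl fun k _ => by ring

theorem integrable_conj_phi_mul (n : ℕ) (m s : Fin (n + 1)) {F : SU2 → ℂ}
    (hF : MemLp F 2 vol) : Integrable (fun z => conj (phi n m s z) * F z) vol :=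
  MemLp.integrable_mul (memLp_of_continuous (Complex.continuous_conj.comp (continuous_phi n m s)) 2)
    hF

/-- The translate `F(g⁻¹ ·)`. -/
def translate (g : SU2) (F : SU2 → ℂ) (z : SU2) : ℂ := F (g⁻¹ * z)

theorem memLp_translate (g : SU2) {F : SU2 → ℂ} (hF : MemLp F 2 vol) :
    MemLp (translate g F) 2 vol :=
  hF.comp_measurePreserving (measurePreserving_mul_left vol g⁻¹)

theorem coeff_translate (n : ℕ) (m s : Fin (n + 1)) (g : SU2) {F : SU2 → ℂ}
    (hF : MemLp F 2 vol) :
    coeff n m s (translate g F) = ∑ k, conj (wignerD n m k g) * coeff n k s F := by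
  have h1 : coeff n m s (translate g F) = ∫ z, conj (phi n m s (g * z)) * F z ∂vol := by
    rw [coeff, ← integral_mul_left_eq_self _ g]
    simp [translate]
  rw [h1]
  simp_rw [phi_mul, map_sum, map_mul, Finset.sum_mul, mul_assoc]
  rw [integral_finsetSum _ fun k _ => (integrable_conj_phi_mul n k s hF).const_mul _]
  exact Finset.sum_congr rfl fun k _ => integral_const_mul _ _

/-- Left translation mixes only the row index `m`, so the projection onto a column commutes with it.
-/
theorem column_translate (n : ℕ) (s : Fin (n + 1)) (g : SU2) {F : SU2 → ℂ}
    (hF : MemLp F 2 vol) (z : SU2) :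
    column n s (translate g F) z = column n s F (g⁻¹ * z) := by
  simp only [column, coeff_translate n _ s g hF, phi_mul, wignerD_inv, Finset.sum_mul,
    Finset.mul_sum]
  rw [Finset.sum_comm]
  exact Finset.sum_congr rfl fun k _ => Finset.sum_congr rfl fun m _ => by ring

/-- Substituting `g z` for `z` leaves the integral unchanged and brings out `D(g)` and `conj D'(g)`.
Schur orthogonality follows. -/
theorem intertwines_integral (n n' : ℕ) (s : Fin (n + 1)) (s' : Fin (n' + 1)) :
    Intertwines n n' fun m m' => ∫ z, wignerD n m s z * conj (wignerD n' m' s' z) ∂vol := by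
  intro g m m'
  dsimp only
  rw [← integral_mul_left_eq_self _ g]
  have hi : ∀ k k', Integrable (fun z => wignerD n k s z * conj (wignerD n' k' s' z)) vol :=
    fun k k' => memLp_one_iff_integrable.mp (memLp_of_continuous ((continuous_wignerD n k s).mul
      (Complex.continuous_conj.comp (continuous_wignerD n' k' s'))) 1)
  simp_rw [← integral_const_mul]
  simp_rw [← integral_finsetSum _ fun k' _ => (hi _ k').const_mul _]
  rw [← integral_finsetSum _ fun k _ => integrable_finsetSum _ fun k' _ =>
    (hi k k').const_mul _]
  refine integral_congr_ae (Eventually.of_forall fun z => ?_)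
  dsimp only
  rw [wignerD_mul, wignerD_mul, map_sum, Finset.sum_mul_sum]
  refine Finset.sum_congr rfl fun k _ => Finset.sum_congr rfl fun k' _ => ?_
  rw [map_mul]
  ring

theorem integral_wignerD_of_ne {n n' : ℕ} (h : n ≠ n') (m s : Fin (n + 1))
    (m' s' : Fin (n' + 1)) : ∫ z, wignerD n m s z * conj (wignerD n' m' s' z) ∂vol = 0 :=
  (intertwines_integral n n' s s').eq_zero_of_ne h m m'

/-- The trace of the intertwiner is the integral of an inner product of columns of a unitary matrix,
hence `0` or the total volume. -/
theorem integral_wignerD (n : ℕ) (m s m' s' : Fin (n + 1)) :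
    ∫ z, wignerD n m s z * conj (wignerD n m' s' z) ∂vol =
      if m' = m ∧ s' = s then 16 * Real.pi ^ 2 / (n + 1 : ℂ) else 0 := by
  have hi : ∀ k k', Integrable (fun z => wignerD n k s z * conj (wignerD n k' s' z)) vol :=
    fun k k' => memLp_one_iff_integrable.mp (memLp_of_continuous ((continuous_wignerD n k s).mul
      (Complex.continuous_conj.comp (continuous_wignerD n k' s'))) 1)
  refine ((intertwines_integral n n s s').eq_trace m m').trans ?_
  rw [← integral_finsetSum _ fun k _ => hi k k]
  have : ∀ z, ∑ k, wignerD n k s z * conj (wignerD n k s' z) = if s' = s then 1 else 0 := by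
    intro z
    rw [← sum_conj_wignerD_mul n s' s z]
    exact Finset.sum_congr rfl fun k _ => mul_comm _ _
  simp_rw [this]
  rw [integral_const, vol_real_univ]
  by_cases h1 : m' = m <;> by_cases h2 : s' = s <;> simp [h1, h2]
  field_simp

theorem norm_const_sq (n : ℕ) : (Real.sqrt (n + 1) / (4 * Real.pi) : ℂ) *
    (Real.sqrt (n + 1) / (4 * Real.pi) : ℂ) = (n + 1) / (16 * Real.pi ^ 2) := by
  have h : (Real.sqrt (n + 1) : ℂ) * Real.sqrt (n + 1) = n + 1 := by
    rw [← Complex.ofReal_mul, Real.mul_self_sqrt (by positivity)]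
    simp
  rw [div_mul_div_comm, h]
  ring

theorem coeff_phi_of_ne {n n' : ℕ} (h : n ≠ n') (m s : Fin (n + 1)) (m' s' : Fin (n' + 1)) :
    coeff n m s (phi n' m' s') = 0 := by
  have h1 : ∀ z, conj (phi n m s z) * phi n' m' s' z =
      (conj (Real.sqrt (n + 1) / (4 * Real.pi) : ℂ) * (Real.sqrt (n' + 1) / (4 * Real.pi) : ℂ)) *
        (wignerD n' m' s' z * conj (wignerD n m s z)) := by
    intro z
    rw [phi, phi, map_mul]
    ring
  rw [coeff]
  simp_rw [h1]
  rw [integral_const_mul, integral_wignerD_of_ne h.symm, mul_zero]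

theorem coeff_phi (n : ℕ) (m s m' s' : Fin (n + 1)) :
    coeff n m s (phi n m' s') = if m' = m ∧ s' = s then 1 else 0 := by
  have h1 : ∀ z, conj (phi n m s z) * phi n m' s' z =
      ((Real.sqrt (n + 1) / (4 * Real.pi) : ℂ) * (Real.sqrt (n + 1) / (4 * Real.pi) : ℂ)) *
        (wignerD n m' s' z * conj (wignerD n m s z)) := by
    intro z
    rw [phi, phi, map_mul]
    have : conj (Real.sqrt (n + 1) / (4 * Real.pi) : ℂ) = Real.sqrt (n + 1) / (4 * Real.pi) := by
      rw [show (Real.sqrt (n + 1) / (4 * Real.pi) : ℂ) =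
        ((Real.sqrt (n + 1) / (4 * Real.pi) : ℝ) : ℂ) by push_cast; rfl, Complex.conj_ofReal]
    rw [this]
    ring
  have hn : (n + 1 : ℂ) ≠ 0 := by exact_mod_cast n.succ_ne_zero
  have hp : (Real.pi : ℂ) ≠ 0 := by exact_mod_cast Real.pi_ne_zero
  rw [coeff]
  simp_rw [h1]
  rw [integral_const_mul, integral_wignerD, norm_const_sq]
  simp only [eq_comm (a := m), eq_comm (a := s)]
  split_ifs
  · field_simp
  · rw [mul_zero]

/-! ### Completeness of the hyperspherical harmonics -/

/-- The monomials in the entries of `h⁻¹`. -/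
def entryMonomial (i j k l : ℕ) (h : SU2) : ℂ :=
  conj (h.1 0 0) ^ i * conj (h.1 1 0) ^ j * (-(h.1 1 0)) ^ k * h.1 0 0 ^ l

/-- The span of all the Wigner functions. -/
def wignerSpan : Submodule ℂ (SU2 → ℂ) :=
  Submodule.span ℂ (Set.range fun i : Σ n : ℕ, Fin (n + 1) × Fin (n + 1) =>
    wignerD i.1 i.2.1 i.2.2)

/-- Multiplying `|α|² + |β|² = 1` by a monomial shows that replacing one factor `conj α · α` by
`conj β · (-β)` changes the result by a monomial of degree two less. This is done `t` times. -/
theorem entryMonomial_exchange (i j k l t : ℕ)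
    (ih : ∀ i' j' k' l', i' + j' + k' + l' < i + t + j + k + (l + t) →
      entryMonomial i' j' k' l' ∈ wignerSpan) :
    entryMonomial (i + t) j k (l + t) - entryMonomial i (j + t) (k + t) l ∈ wignerSpan := by
  induction t generalizing i j k l with
  | zero => simp
  | succ t iht =>
    have h1 := iht (i + 1) j k (l + 1) fun i' j' k' l' h => ih i' j' k' l' (by omega)
    have h2 : entryMonomial (i + 1) (j + t) (k + t) (l + 1) -
        entryMonomial i (j + (t + 1)) (k + (t + 1)) l = entryMonomial i (j + t) (k + t) l := by
      funext h
      simp only [Pi.sub_apply, entryMonomial]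
      linear_combination (conj (h.1 0 0) ^ i * conj (h.1 1 0) ^ (j + t) * (-(h.1 1 0)) ^ (k + t) *
        h.1 0 0 ^ l) * SU2.conj_mul_add_conj_mul h
    have h3 := wignerSpan.add_mem h1 (h2 ▸ ih i (j + t) (k + t) l (by omega))
    convert h3 using 1
    rw [show i + 1 + t = i + (t + 1) by omega, show l + 1 + t = l + (t + 1) by omega]
    abel

/-- The three sums determine the exponents up to one shift parameter, which is the number of
exchanges. -/
theorem entryMonomial_sub_mem {i j k l i' j' k' l' : ℕ} (h1 : i + j = i' + j')
    (h2 : i + k = i' + k') (h3 : k + l = k' + l')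
    (ih : ∀ i' j' k' l', i' + j' + k' + l' < i + j + k + l →
      entryMonomial i' j' k' l' ∈ wignerSpan) :
    entryMonomial i j k l - entryMonomial i' j' k' l' ∈ wignerSpan := by
  rcases le_total i i' with h | h
  · obtain ⟨t, rfl⟩ := Nat.exists_eq_add_of_le h
    obtain rfl : j = j' + t := by omega
    obtain rfl : k = k' + t := by omega
    obtain rfl : l' = l + t := by omega
    rw [← neg_sub]
    exact wignerSpan.neg_mem (entryMonomial_exchange i j' k' l t
      fun a b c d h => ih a b c d (by omega))
  · obtain ⟨t, rfl⟩ := Nat.exists_eq_add_of_le h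
    obtain rfl : j' = j + t := by omega
    obtain rfl : k' = k + t := by omega
    obtain rfl : l = l' + t := by omega
    exact entryMonomial_exchange i' j k l' t fun a b c d h => ih a b c d (by omega)

/-- Induction on the degree `N`. Up to scale, the Wigner function with row `i + k` and column `i +
j` is a positive combination of monomials that all agree with the given one modulo lower degree, so
it is a nonzero multiple of that monomial modulo the span. -/
theorem entryMonomial_mem (i j k l : ℕ) : entryMonomial i j k l ∈ wignerSpan := by
  induction hN : i + j + k + l using Nat.strong_induction_on generalizing i j k l with
  | _ N ih =>
    have ih' : ∀ i' j' k' l', i' + j' + k' + l' < i + j + k + l →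
        entryMonomial i' j' k' l' ∈ wignerSpan := fun a b c d h => ih _ (by omega) a b c d rfl
    set w : SU2 → ℂ := ∑ x ∈ Finset.HasAntidiagonal.antidiagonal (i + k),
      (((i + j).choose x.1 * (k + l).choose x.2 : ℕ) : ℂ) •
        entryMonomial x.1 (i + j - x.1) x.2 (k + l - x.2) with hw
    have hwm : w ∈ wignerSpan := by
      have hm : wignerD N ⟨i + k, by omega⟩ ⟨i + j, by omega⟩ ∈ wignerSpan :=
        Submodule.subset_span ⟨⟨N, ⟨i + k, by omega⟩, ⟨i + j, by omega⟩⟩, rfl⟩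
      have hs : w = ((Real.sqrt (N.choose (i + k)) / Real.sqrt (N.choose (i + j)) : ℂ)) •
          wignerD N ⟨i + k, by omega⟩ ⟨i + j, by omega⟩ := by
        funext h
        have n1 := sqrt_choose_ne_zero N ⟨i + k, by omega⟩
        have n2 := sqrt_choose_ne_zero N ⟨i + j, by omega⟩
        dsimp only at n1 n2
        rw [Pi.smul_apply, wignerD_eq_sum, smul_eq_mul, ← mul_assoc]
        dsimp only
        rw [div_mul_div_comm, mul_comm (Real.sqrt (N.choose (i + k)) : ℂ),
          div_self (mul_ne_zero n2 n1), one_mul, hw, Finset.sum_apply]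
        refine Finset.sum_congr rfl fun x _ => ?_
        rw [show N - (i + j) = k + l by omega, Pi.smul_apply, entryMonomial, smul_eq_mul]
        push_cast
        ring
      rw [hs]
      exact wignerSpan.smul_mem _ hm
    have hsub : ((N.choose (i + k) : ℕ) : ℂ) • entryMonomial i j k l - w ∈ wignerSpan := by
      -- Vandermonde's identity: the total weight of the monomials in `w`.
      have hv : N.choose (i + k) = ∑ x ∈ Finset.HasAntidiagonal.antidiagonal (i + k),
          (i + j).choose x.1 * (k + l).choose x.2 := by
        rw [← Nat.add_choose_eq]
        congr 1
        omega
      rw [hv, hw, Nat.cast_sum, Finset.sum_smul, ← Finset.sum_sub_distrib]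
      refine wignerSpan.sum_mem fun x hx => ?_
      rw [← smul_sub]
      rw [Finset.HasAntidiagonal.mem_antidiagonal] at hx
      -- Outside these ranges the truncated exponents are meaningless, but the binomial weight is
      -- zero.
      by_cases hx1 : x.1 ≤ i + j
      · by_cases hx2 : x.2 ≤ k + l
        · exact wignerSpan.smul_mem _ (entryMonomial_sub_mem (by omega) (by omega) (by omega) ih')
        · rw [Nat.choose_eq_zero_of_lt (by omega : k + l < x.2)]
          simp
      · rw [Nat.choose_eq_zero_of_lt (by omega : i + j < x.1)]
        simp
    have h := wignerSpan.add_mem hsub hwm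
    rw [sub_add_cancel] at h
    have hne : ((N.choose (i + k) : ℕ) : ℂ) ≠ 0 := by
      exact_mod_cast (Nat.choose_pos (by omega : i + k ≤ N)).ne'
    have h4 := wignerSpan.smul_mem (((N.choose (i + k) : ℕ) : ℂ))⁻¹ h
    rwa [smul_smul, inv_mul_cancel₀ hne, one_smul] at h4

/-- A matrix entry as a continuous function. -/
def entryMap (i j : Fin 2) : C(SU2, ℂ) := ⟨fun h => h.1 i j, SU2.continuous_apply i j⟩

/-- The algebra of polynomials in the entries and their conjugates. -/
def entryAlgebra : StarSubalgebra ℂ C(SU2, ℂ) :=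
  StarAlgebra.adjoin ℂ {entryMap 0 0, entryMap 1 0}

theorem entryAlgebra_separatesPoints : entryAlgebra.SeparatesPoints := by
  intro x y hxy
  by_contra! h
  refine hxy ?_
  have h0 : x.1 0 0 = y.1 0 0 := by
    exact h _ ⟨entryMap 0 0, StarAlgebra.subset_adjoin ℂ _ (by simp), rfl⟩
  have h1 : x.1 1 0 = y.1 1 0 := by
    exact h _ ⟨entryMap 1 0, StarAlgebra.subset_adjoin ℂ _ (by simp), rfl⟩
  ext i j
  fin_cases i <;> fin_cases j
  · exact h0
  · change x.1 0 1 = y.1 0 1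
    rw [SU2.apply_zero_one, SU2.apply_zero_one, h1]
  · exact h1
  · change x.1 1 1 = y.1 1 1
    rw [SU2.apply_one_one, SU2.apply_one_one, h0]

/-- The algebra is spanned by words in the generators and their conjugates, and each word is a
scalar times a monomial; the scalar absorbs the sign of `-β`. -/
theorem coe_mem_wignerSpan {f : C(SU2, ℂ)} (hf : f ∈ entryAlgebra) : ⇑f ∈ wignerSpan := by
  have hf' : f ∈ Algebra.adjoin ℂ (({entryMap 0 0, entryMap 1 0} : Set C(SU2, ℂ)) ∪
    star {entryMap 0 0, entryMap 1 0}) := hf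
  rw [← Subalgebra.mem_toSubmodule, Algebra.adjoin_eq_span] at hf'
  have hle : Submodule.span ℂ (Submonoid.closure (({entryMap 0 0, entryMap 1 0} :
      Set C(SU2, ℂ)) ∪ star {entryMap 0 0, entryMap 1 0}) : Set C(SU2, ℂ)) ≤
      wignerSpan.comap (ContinuousMap.coeFnLinearMap ℂ) := by
    rw [Submodule.span_le]
    intro f hf
    have : ∃ (z : ℂ) (i j k l : ℕ), ⇑f = z • entryMonomial i j k l := by
      induction hf using Submonoid.closure_induction with
      | mem x hx =>
        rcases hx with hx | hx
        · rcases hx with rfl | rfl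
          · exact ⟨1, 0, 0, 0, 1, by ext h; simp [entryMonomial, entryMap]⟩
          · exact ⟨-1, 0, 0, 1, 0, by ext h; simp [entryMonomial, entryMap]⟩
        · rw [Set.mem_star] at hx
          rcases hx with hx | hx
          · rw [star_eq_iff_star_eq, eq_comm] at hx
            subst hx
            exact ⟨1, 1, 0, 0, 0, by ext h; simp [entryMonomial, entryMap]⟩
          · rw [Set.mem_singleton_iff, star_eq_iff_star_eq, eq_comm] at hx
            subst hx
            exact ⟨1, 0, 1, 0, 0, by ext h; simp [entryMonomial, entryMap]⟩
      | one => exact ⟨1, 0, 0, 0, 0, by ext h; simp [entryMonomial]⟩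
      | mul x y _ _ hx hy =>
        obtain ⟨z, i, j, k, l, hx⟩ := hx
        obtain ⟨z', i', j', k', l', hy⟩ := hy
        refine ⟨z * z', i + i', j + j', k + k', l + l', ?_⟩
        rw [ContinuousMap.coe_mul, hx, hy]
        ext h
        simp only [Pi.mul_apply, Pi.smul_apply, smul_eq_mul, entryMonomial]
        ring
    obtain ⟨z, i, j, k, l, h⟩ := this
    change ⇑f ∈ wignerSpan
    rw [h]
    exact wignerSpan.smul_mem _ (entryMonomial_mem i j k l)
  exact hle hf'

/-- The index set of the hyperspherical harmonics. -/
abbrev HarmonicIndex : Type := Σ n : ℕ, Fin (n + 1) × Fin (n + 1)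

/-- The hyperspherical harmonics as continuous functions. -/
def phiMap (i : HarmonicIndex) : C(SU2, ℂ) := ⟨phi i.1 i.2.1 i.2.2, continuous_phi _ _ _⟩

/-- Stone-Weierstrass: the span contains the point-separating star algebra generated by the entries.
-/
theorem span_phiMap_closure_eq_top :
    (Submodule.span ℂ (Set.range phiMap)).topologicalClosure = ⊤ := by
  have h1 : ∀ f ∈ entryAlgebra, f ∈ Submodule.span ℂ (Set.range phiMap) := by
    intro f hf
    have h2 : wignerSpan ≤ (Submodule.span ℂ (Set.range phiMap)).map
        (ContinuousMap.coeFnLinearMap ℂ) := by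
      rw [wignerSpan, Submodule.span_le]
      rintro _ ⟨i, rfl⟩
      refine ⟨((Real.sqrt (i.1 + 1) / (4 * Real.pi) : ℂ))⁻¹ • phiMap i,
        Submodule.smul_mem _ _ (Submodule.subset_span ⟨i, rfl⟩), ?_⟩
      ext h
      have hc : (Real.sqrt (i.1 + 1) / (4 * Real.pi) : ℂ) ≠ 0 := by
        intro h0
        have := norm_const_sq i.1
        rw [h0, zero_mul, eq_comm, div_eq_zero_iff] at this
        rcases this with h | h
        · exact Nat.cast_add_one_ne_zero i.1 h
        · simp [Real.pi_ne_zero] at h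
      change (Real.sqrt (i.1 + 1) / (4 * Real.pi) : ℂ)⁻¹ * phi i.1 i.2.1 i.2.2 h = _
      rw [phi, inv_mul_cancel_left₀ hc]
    obtain ⟨f', hf', he⟩ := h2 (coe_mem_wignerSpan hf)
    have : f' = f := by ext h; exact congrFun he h
    exact this ▸ hf'
  have h3 := ContinuousMap.starSubalgebra_topologicalClosure_eq_top_of_separatesPoints
    entryAlgebra entryAlgebra_separatesPoints
  rw [eq_top_iff]
  intro f _
  have h4 : f ∈ entryAlgebra.topologicalClosure := h3 ▸ trivial
  exact closure_mono h1 h4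

/-- The hyperspherical harmonics as elements of `L²`. -/
def phiL2 (i : HarmonicIndex) : L2 := ContinuousMap.toLp 2 vol ℂ (phiMap i)

theorem span_phiL2_closure_eq_top :
    (Submodule.span ℂ (Set.range phiL2)).topologicalClosure = ⊤ := by
  convert! (ContinuousMap.toLp_denseRange ℂ vol ℂ
    (by simp : (2 : ℝ≥0∞) ≠ ∞)).topologicalClosure_map_submodule span_phiMap_closure_eq_top
  rw [Submodule.map_span]
  unfold phiL2
  rw [Set.range_comp']
  simp only [ContinuousLinearMap.coe_coe]

theorem toL2_of_memLp {F : SU2 → ℂ} (hF : MemLp F 2 vol) : toL2 F = hF.toLp F := dif_pos hF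

theorem inner_phiL2_toL2 (i : HarmonicIndex) {F : SU2 → ℂ} (hF : MemLp F 2 vol) :
    inner ℂ (phiL2 i) (toL2 F) = coeff i.1 i.2.1 i.2.2 F := by
  rw [toL2_of_memLp hF, L2.inner_def, coeff]
  refine integral_congr_ae ?_
  filter_upwards [ContinuousMap.coeFn_toLp (p := 2) (𝕜 := ℂ) vol (phiMap i), hF.coeFn_toLp]
    with z h1 h2
  rw [h2, phiL2, h1, RCLike.inner_apply, mul_comm]
  rfl

theorem phiL2_eq_toL2 (i : HarmonicIndex) : phiL2 i = toL2 (phi i.1 i.2.1 i.2.2) := by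
  rw [toL2_of_memLp (memLp_of_continuous (continuous_phi _ _ _) 2)]
  rfl

theorem orthonormal_phiL2 : Orthonormal ℂ phiL2 := by
  rw [orthonormal_iff_ite]
  rintro ⟨n, m, s⟩ ⟨n', m', s'⟩
  rw [phiL2_eq_toL2 ⟨n', m', s'⟩,
    inner_phiL2_toL2 _ (memLp_of_continuous (continuous_phi _ _ _) 2)]
  dsimp only
  by_cases h : n = n'
  · subst h
    rw [coeff_phi]
    refine if_congr ?_ rfl rfl
    simp [Prod.ext_iff, eq_comm]
  · rw [coeff_phi_of_ne h, if_neg fun h' => h (congrArg Sigma.fst h')]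

/-- The hyperspherical harmonics form an orthonormal basis of `L²(SU(2))`. -/
def phiBasis : HilbertBasis HarmonicIndex ℂ L2 :=
  HilbertBasis.mk orthonormal_phiL2 span_phiL2_closure_eq_top.ge

/-- The indices of degree less than `N`. -/
def degreesBelow (N : ℕ) : Finset HarmonicIndex := (Finset.range N).sigma fun _ => Finset.univ

/-- Partial sums of the Fourier expansion. -/
def partialSum (N : ℕ) (F : SU2 → ℂ) (z : SU2) : ℂ :=
  ∑ i ∈ degreesBelow N, coeff i.1 i.2.1 i.2.2 F * phi i.1 i.2.1 i.2.2 z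

theorem tendsto_degreesBelow : Tendsto degreesBelow atTop atTop := by
  refine tendsto_atTop_finset_of_monotone ?_ fun i => ⟨i.1 + 1, ?_⟩
  · intro N N' h
    exact Finset.sigma_mono (Finset.range_mono h) fun _ => le_rfl
  · simp [degreesBelow]

theorem tendsto_sum_coeff_smul_phiL2 {F : SU2 → ℂ} (hF : MemLp F 2 vol) :
    Tendsto (fun N => ∑ i ∈ degreesBelow N, coeff i.1 i.2.1 i.2.2 F • phiL2 i) atTop
      (𝓝 (toL2 F)) := by
  have h := (phiBasis.hasSum_repr (toL2 F)).comp tendsto_degreesBelow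
  refine h.congr fun N => Finset.sum_congr rfl fun i _ => ?_
  have hb : phiBasis i = phiL2 i := congrFun (HilbertBasis.coe_mk _ _) i
  have hr := phiBasis.repr_apply_apply (toL2 F) i
  rw [hb, inner_phiL2_toL2 i hF] at hr
  exact congrArg₂ (· • ·) hr hb

theorem toLp_eq_toL2 (f : C(SU2, ℂ)) : ContinuousMap.toLp 2 vol ℂ f = toL2 f := by
  rw [toL2_of_memLp (memLp_of_continuous f.continuous 2)]
  rfl

theorem continuous_partialSum (N : ℕ) (F : SU2 → ℂ) : Continuous (partialSum N F) :=
  continuous_finsetSum _ fun _ _ => continuous_const.mul (continuous_phi _ _ _)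

theorem sum_coeff_smul_phiL2 (N : ℕ) (F : SU2 → ℂ) :
    ∑ i ∈ degreesBelow N, coeff i.1 i.2.1 i.2.2 F • phiL2 i = toL2 (partialSum N F) := by
  have h := toLp_eq_toL2 (∑ i ∈ degreesBelow N, coeff i.1 i.2.1 i.2.2 F • phiMap i)
  rw [map_sum] at h
  simp_rw [map_smul] at h
  refine h.trans (congrArg toL2 ?_)
  ext z
  rw [ContinuousMap.sum_apply]
  rfl

theorem tendsto_eLpNorm_partialSum {F : SU2 → ℂ} (hF : MemLp F 2 vol) :
    Tendsto (fun N => eLpNorm (partialSum N F - F) 2 vol) atTop (𝓝 0) := by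
  have h := tendsto_sum_coeff_smul_phiL2 hF
  simp_rw [sum_coeff_smul_phiL2,
    fun N => toL2_of_memLp (memLp_of_continuous (continuous_partialSum N F) 2)] at h
  rw [toL2_of_memLp hF] at h
  exact (Lp.tendsto_Lp_iff_tendsto_eLpNorm'' _ _ _ hF).mp h

/-! ### Finite expansions -/

theorem coeff_sum {ι : Type*} (S : Finset ι) (c : ι → ℂ) (f : ι → SU2 → ℂ)
    (hf : ∀ i, Continuous (f i)) (n : ℕ) (m s : Fin (n + 1)) :
    coeff n m s (fun z => ∑ i ∈ S, c i * f i z) = ∑ i ∈ S, c i * coeff n m s (f i) := by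
  simp only [coeff, Finset.mul_sum]
  rw [integral_finsetSum _ fun i _ => ?_]
  · refine Finset.sum_congr rfl fun i _ => ?_
    rw [← integral_const_mul]
    exact integral_congr_ae (Eventually.of_forall fun z => by ring)
  · exact integrable_conj_phi_mul n m s
      (memLp_of_continuous (continuous_const.mul (hf i)) 2)

/-- Point evaluations span the dual of the space of columns. -/
theorem exists_finsupp_eval_column (n : ℕ) (m s : Fin (n + 1)) :
    ∃ r : SU2 →₀ ℂ, ∀ c : Fin (n + 1) → ℂ,
      (r.sum fun z w => w * ∑ k, c k * phi n k s z) = c m := by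
  -- A functional vanishing on all evaluation vectors would be a linear relation among the harmonics
  -- of the column, excluded by orthonormality.
  have hspan : Submodule.span ℂ (Set.range fun (z : SU2) (k : Fin (n + 1)) => phi n k s z) = ⊤ := by
    by_contra hne
    obtain ⟨f, hf0, hf⟩ := Submodule.exists_le_ker_of_lt_top _ (lt_top_iff_ne_top.mpr hne)
    refine hf0 ?_
    have h1 : ∀ v : Fin (n + 1) → ℂ, f v = ∑ k, f (Pi.single k 1) * v k := by
      intro v
      conv_lhs => rw [← Finset.univ_sum_single v, map_sum]
      refine Finset.sum_congr rfl fun k _ => ?_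
      have : Pi.single k (v k) = v k • (Pi.single k 1 : Fin (n + 1) → ℂ) := by
        rw [← Pi.single_smul, smul_eq_mul, mul_one]
      rw [this, map_smul, smul_eq_mul, mul_comm]
    have h2 : ∀ z, ∑ k, f (Pi.single k 1) * phi n k s z = 0 := by
      intro z
      rw [← h1 fun k => phi n k s z]
      exact hf (Submodule.subset_span ⟨z, rfl⟩)
    have h3 : ∀ k, f (Pi.single k 1) = 0 := by
      intro k
      have h4 := coeff_sum Finset.univ (fun k => f (Pi.single k 1)) (fun k => phi n k s)
        (fun k => continuous_phi n k s) n k s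
      simp only [h2, coeff_phi, and_true] at h4
      simpa [coeff] using h4.symm
    ext v
    simp [h3]
  have hm : (Pi.single m 1 : Fin (n + 1) → ℂ) ∈ Submodule.span ℂ
      (Set.range fun (z : SU2) (k : Fin (n + 1)) => phi n k s z) := hspan ▸ trivial
  obtain ⟨r, hr⟩ := Finsupp.mem_span_range_iff_exists_finsupp.mp hm
  refine ⟨r, fun c => ?_⟩
  have h1 : ∀ k, (r.sum fun z w => w * phi n k s z) = (Pi.single m 1 : Fin (n + 1) → ℂ) k := by
    intro k
    rw [← hr]
    simp [Finsupp.sum, Finset.sum_apply]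
  have h2 : (r.sum fun z w => w * ∑ k, c k * phi n k s z) =
      ∑ k, c k * r.sum fun z w => w * phi n k s z := by
    simp only [Finsupp.sum, Finset.mul_sum]
    rw [Finset.sum_comm]
    exact Finset.sum_congr rfl fun k _ => Finset.sum_congr rfl fun z _ => by ring
  rw [h2]
  simp [h1, Pi.single_apply]

theorem partialSum_eq_sum_column (N : ℕ) (F : SU2 → ℂ) (z : SU2) :
    partialSum N F z = ∑ n ∈ Finset.range N, ∑ s, column n s F z := by
  rw [partialSum, degreesBelow, Finset.sum_sigma]
  refine Finset.sum_congr rfl fun n _ => ?_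
  rw [← Finset.univ_product_univ, Finset.sum_product_right]
  rfl

theorem partialSum_translate (N : ℕ) (g : SU2) {F : SU2 → ℂ} (hF : MemLp F 2 vol) (z : SU2) :
    partialSum N (translate g F) z = partialSum N F (g⁻¹ * z) := by
  simp only [partialSum_eq_sum_column, column_translate _ _ g hF]

/-! ### Limits of identically distributed sequences -/

theorem identDistrib_congr_ae {α β : Type*} [MeasurableSpace α] [MeasurableSpace β]
    {μ : Measure α} {f f' g g' : α → β} (h : IdentDistrib f g μ μ) (hf : f =ᵐ[μ] f')
    (hg : g =ᵐ[μ] g') : IdentDistrib f' g' μ μ :=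
  ((IdentDistrib.of_ae_eq h.aemeasurable_fst hf).symm.trans h).trans
    (IdentDistrib.of_ae_eq h.aemeasurable_snd hg)

theorem identDistrib_of_tendstoInDistribution {α E : Type*} [MeasurableSpace α]
    [MeasurableSpace E] [TopologicalSpace E] [BorelSpace E] [HasOuterApproxClosed E]
    {μ : Measure α} [IsProbabilityMeasure μ] {U V : ℕ → α → E} {Z W : α → E}
    (h : ∀ N, IdentDistrib (U N) (V N) μ μ)
    (hU : TendstoInDistribution U atTop Z (fun _ => μ) μ)
    (hV : TendstoInDistribution V atTop W (fun _ => μ) μ) : IdentDistrib Z W μ μ where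
  aemeasurable_fst := hU.aemeasurable_limit
  aemeasurable_snd := hV.aemeasurable_limit
  map_eq := by
    have h2 : TendstoInDistribution U atTop W (fun _ => μ) μ := by
      refine ⟨fun N => (h N).aemeasurable_fst, hV.aemeasurable_limit, ?_⟩
      have h3 := hV.tendsto
      simp_rw [fun N => (h N).map_eq.symm] at h3
      exact h3
    exact tendstoInDistribution_unique U hU h2

theorem identDistrib_of_tendsto_ae {α E : Type*} [MeasurableSpace α]
    [MeasurableSpace E] [TopologicalSpace E] [BorelSpace E] [TopologicalSpace.PseudoMetrizableSpace E]
    {μ : Measure α} [IsProbabilityMeasure μ] {U V : ℕ → α → E} {Z W : α → E}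
    (h : ∀ N, IdentDistrib (U N) (V N) μ μ)
    (hU : ∀ᵐ ω ∂μ, Tendsto (fun N => U N ω) atTop (𝓝 (Z ω)))
    (hV : ∀ᵐ ω ∂μ, Tendsto (fun N => V N ω) atTop (𝓝 (W ω))) : IdentDistrib Z W μ μ :=
  identDistrib_of_tendstoInDistribution h
    (tendstoInDistribution_of_ae_tendsto (fun N => (h N).aemeasurable_fst)
      (aemeasurable_of_tendsto_metrizable_ae atTop (fun N => (h N).aemeasurable_fst) hU) hU)
    (tendstoInDistribution_of_ae_tendsto (fun N => (h N).aemeasurable_snd)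
      (aemeasurable_of_tendsto_metrizable_ae atTop (fun N => (h N).aemeasurable_snd) hV) hV)

/-! ### Invariance of the Fourier coefficients -/

/-- The family of all Fourier coefficients. -/
def coeffs (F : SU2 → ℂ) (i : HarmonicIndex) : ℂ := coeff i.1 i.2.1 i.2.2 F

section

variable {Ω : Type*} [MeasurableSpace Ω] {P : Measure Ω} {X : Ω → SU2 → ℂ}

/-- The joint law of the Fourier coefficients is invariant under left translations. -/
def CoeffInvariant (P : Measure Ω) (X : Ω → SU2 → ℂ) : Prop :=
  ∀ g : SU2, IdentDistrib (fun ω => coeffs (translate g (X ω))) (fun ω => coeffs (X ω)) P P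

theorem IsSquareIntegrableField.translate (hX : IsSquareIntegrableField P X) (g : SU2) :
    IsSquareIntegrableField P fun ω => translate g (X ω) where
  measurable := hX.measurable.comp
    (measurable_fst.prodMk ((measurable_const_mul g⁻¹).comp measurable_snd))
  memLp := hX.memLp.mono fun _ h => memLp_translate g h

theorem IsSquareIntegrableField.measurable_coeff (hX : IsSquareIntegrableField P X) (n : ℕ)
    (m s : Fin (n + 1)) : Measurable fun ω => coeff n m s (X ω) := by
  have h : Measurable (Function.uncurry fun ω z => conj (phi n m s z) * X ω z) :=
    ((Complex.continuous_conj.comp (continuous_phi n m s)).measurable.comp measurable_snd).mul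
      hX.measurable
  exact h.stronglyMeasurable.integral_prod_right.measurable

theorem IsSquareIntegrableField.measurable_coeffs (hX : IsSquareIntegrableField P X) :
    Measurable fun ω => coeffs (X ω) :=
  measurable_pi_lambda _ fun _ => hX.measurable_coeff _ _ _

theorem LeftInvariant.coeffInvariant (hX : IsSquareIntegrableField P X) (h : LeftInvariant P X) :
    CoeffInvariant P X := by
  intro g
  have hm : Measurable fun (x : L2) (i : HarmonicIndex) => inner ℂ (phiL2 i) x :=
    measurable_pi_lambda _ fun i => (continuous_const.inner continuous_id).measurable
  refine identDistrib_congr_ae ((h g).comp hm) ?_ ?_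
  · filter_upwards [(hX.translate g).memLp] with ω hω
    exact funext fun i => inner_phiL2_toL2 i hω
  · filter_upwards [hX.memLp] with ω hω
    exact funext fun i => inner_phiL2_toL2 i hω

/-- Each partial sum in L² is a continuous function of the coefficients and so has an invariant law.
Passing to the almost sure limit avoids a reconstruction map, which would be undefined on sequences
that are not square summable. -/
theorem CoeffInvariant.leftInvariant [IsProbabilityMeasure P] (hX : IsSquareIntegrableField P X)
    (h : CoeffInvariant P X) : LeftInvariant P X := by
  intro g
  have hm : ∀ N, Measurable fun c : HarmonicIndex → ℂ => ∑ i ∈ degreesBelow N, c i • phiL2 i := by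
    intro N
    refine Continuous.measurable (continuous_finsetSum _ fun i _ => ?_)
    exact (continuous_apply i).smul continuous_const
  refine identDistrib_of_tendsto_ae (fun N => (h g).comp (hm N)) ?_ ?_
  · filter_upwards [(hX.translate g).memLp] with ω hω
    exact tendsto_sum_coeff_smul_phiL2 hω
  · filter_upwards [hX.memLp] with ω hω
    exact tendsto_sum_coeff_smul_phiL2 hω

theorem CoeffInvariant.jointlyLeftInvariant_columns (hX : IsSquareIntegrableField P X)
    (h : CoeffInvariant P X) : JointlyLeftInvariant P (columns X) := by
  intro g
  have hm : Measurable fun (c : HarmonicIndex → ℂ) (p : (Σ n : ℕ, Fin (n + 1)) × SU2) =>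
      ∑ m, c ⟨p.1.1, m, p.1.2⟩ * phi p.1.1 m p.1.2 p.2 :=
    measurable_pi_lambda _ fun p => Finset.measurable_fun_sum _ fun m _ =>
      (measurable_pi_apply _).mul_const _
  refine identDistrib_congr_ae ((h g).comp hm) ?_ (Eventually.of_forall fun ω => rfl)
  filter_upwards [hX.memLp] with ω hω
  exact funext fun p => column_translate p.1.1 p.1.2 g hω p.2

/-- Each coefficient is a fixed finite combination of point values of its column, so the whole
coefficient family is a measurable function of those values for the product `σ`-algebra. -/
theorem coeffInvariant_of_columns (hX : IsSquareIntegrableField P X)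
    (h : JointlyLeftInvariant P (columns X)) : CoeffInvariant P X := by
  intro g
  choose r hr using fun i : HarmonicIndex => exists_finsupp_eval_column i.1 i.2.1 i.2.2
  have hm : Measurable fun (y : (Σ n : ℕ, Fin (n + 1)) × SU2 → ℂ) (i : HarmonicIndex) =>
      (r i).sum fun z w => w * y (⟨i.1, i.2.2⟩, z) :=
    measurable_pi_lambda _ fun i => Finset.measurable_fun_sum _ fun z _ =>
      (measurable_pi_apply _).const_mul _
  refine identDistrib_congr_ae ((h g).comp hm) ?_ (Eventually.of_forall fun ω => ?_)
  · filter_upwards [hX.memLp] with ω hω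
    funext i
    refine Eq.trans ?_ (hr i fun m => coeff i.1 m i.2.2 (translate g (X ω)))
    refine Finset.sum_congr rfl fun z _ => ?_
    exact congrArg (r i z * ·) (column_translate i.1 i.2.2 g hω z).symm
  · funext i
    exact hr i fun m => coeff i.1 m i.2.2 (X ω)

end

section

variable {Ω : Type*} [MeasurableSpace Ω] {P : Measure Ω} {X : Ω → SU2 → ℂ}

/-! ### Monte Carlo integration -/

/-- The Haar probability measure. -/
def haar : Measure SU2 := Measure.haarMeasure (⊤ : TopologicalSpace.PositiveCompacts SU2)

instance : IsProbabilityMeasure haar := ⟨Measure.haarMeasure_self (K₀ := ⊤)⟩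

instance : haar.IsMulLeftInvariant := by unfold haar; infer_instance

theorem vol_eq_smul_haar : vol = ENNReal.ofReal (16 * Real.pi ^ 2) • haar := rfl

theorem integral_vol (f : SU2 → ℂ) :
    ∫ z, f z ∂vol = ((16 * Real.pi ^ 2 : ℝ) : ℂ) * ∫ z, f z ∂haar := by
  rw [vol_eq_smul_haar, integral_smul_measure, ENNReal.toReal_ofReal (by positivity),
    Complex.real_smul]

theorem integrable_haar_of_vol {f : SU2 → ℂ} (hf : Integrable f vol) : Integrable f haar := by
  refine (integrable_smul_measure ?_ ENNReal.ofReal_ne_top).mp hf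
  simp

/-- Sequences of independent Haar distributed points. -/
def haarSeq : Measure (ℕ → SU2) := Measure.infinitePi fun _ => haar

instance : IsProbabilityMeasure haarSeq := by unfold haarSeq; infer_instance

/-- The Monte Carlo approximation of the Fourier coefficients. -/
def sampleCoeffs (N : ℕ) (u : ℕ → SU2) (F : SU2 → ℂ) (i : HarmonicIndex) : ℂ :=
  ((16 * Real.pi ^ 2 : ℝ) : ℂ) *
    (((N : ℝ)⁻¹ : ℝ) * ∑ j ∈ Finset.range N, conj (phi i.1 i.2.1 i.2.2 (u j)) * F (u j))

/-- The strong law of large numbers for each of the countably many coefficients. -/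
theorem tendsto_sampleCoeffs {F : SU2 → ℂ} (hm : Measurable F) (hF : MemLp F 2 vol) :
    ∀ᵐ u ∂haarSeq, Tendsto (fun N => sampleCoeffs N u F) atTop (𝓝 (coeffs F)) := by
  simp_rw [tendsto_pi_nhds]
  rw [ae_all_iff]
  intro i
  set f : SU2 → ℂ := fun z => conj (phi i.1 i.2.1 i.2.2 z) * F z with hf
  have hfm : Measurable f :=
    (Complex.continuous_conj.comp (continuous_phi _ _ _)).measurable.mul hm
  have hfi : Integrable f haar := integrable_haar_of_vol (integrable_conj_phi_mul _ _ _ hF)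
  have hp : ∀ j : ℕ, MeasurePreserving (fun u : ℕ → SU2 => u j) haarSeq haar := fun j =>
    measurePreserving_eval_infinitePi (fun _ => haar) j
  have hind : iIndepFun (fun (j : ℕ) (u : ℕ → SU2) => f (u j)) haarSeq :=
    iIndepFun_infinitePi (P := fun _ : ℕ => haar) (X := fun _ => f) fun _ => hfm
  have h := strong_law_ae (μ := haarSeq) (fun j (u : ℕ → SU2) => f (u j))
    ((hp 0).integrable_comp_of_integrable hfi) (fun j k hjk => hind.indepFun hjk)
    fun j => ⟨(hfm.comp (hp j).measurable).aemeasurable, (hfm.comp (hp 0).measurable).aemeasurable,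
      by
        refine (Measure.map_map hfm (hp j).measurable).symm.trans
          (Eq.trans ?_ (Measure.map_map hfm (hp 0).measurable))
        rw [(hp j).map_eq, (hp 0).map_eq]⟩
  filter_upwards [h] with u hu
  have h1 : ∫ u : ℕ → SU2, f (u 0) ∂haarSeq = ∫ z, f z ∂haar := by
    rw [← (hp 0).map_eq, integral_map (hp 0).measurable.aemeasurable hfm.aestronglyMeasurable]
  rw [h1] at hu
  rw [coeffs, coeff, integral_vol]
  simp_rw [Complex.real_smul] at hu
  exact hu.const_mul _

theorem measurable_sampleCoeffs (hX : IsSquareIntegrableField P X) (N : ℕ) :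
    Measurable fun p : Ω × (ℕ → SU2) => sampleCoeffs N p.2 (X p.1) := by
  refine measurable_pi_lambda _ fun i => Measurable.const_mul (Measurable.const_mul
    (Finset.measurable_fun_sum _ fun j _ => ?_) _) _
  have hj : Measurable fun p : Ω × (ℕ → SU2) => p.2 j :=
    (measurable_pi_apply j).comp measurable_snd
  exact ((Complex.continuous_conj.comp (continuous_phi _ _ _)).measurable.comp hj).mul
    (hX.measurable.comp (measurable_fst.prodMk hj))

theorem ae_tendsto_sampleCoeffs [IsProbabilityMeasure P] (hX : IsSquareIntegrableField P X) :
    ∀ᵐ p ∂P.prod haarSeq, Tendsto (fun N => sampleCoeffs N p.2 (X p.1)) atTop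
      (𝓝 (coeffs (X p.1))) := by
  rw [Measure.ae_prod_iff_ae_ae]
  · filter_upwards [hX.memLp] with ω hω
    exact tendsto_sampleCoeffs (hX.measurable.comp measurable_prodMk_left) hω
  · exact measurableSet_tendsto_fun (measurable_sampleCoeffs hX)
      (hX.measurable_coeffs.comp measurable_fst)

theorem measurable_sampleCoeffs_values (N : ℕ) (u : ℕ → SU2) :
    Measurable fun y : Unit × SU2 → ℂ => sampleCoeffs N u fun z => y ((), z) := by
  refine measurable_pi_lambda _ fun i => Measurable.const_mul (Measurable.const_mul
    (Finset.measurable_fun_sum _ fun j _ => ?_) _) _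
  exact (measurable_pi_apply _).const_mul _

/-- For a frozen sample `u` the approximation depends on finitely many values of the field, so
pointwise invariance applies; then integrate over `u`. -/
theorem PointwiseLeftInvariant.identDistrib_sampleCoeffs [IsProbabilityMeasure P]
    (hX : IsSquareIntegrableField P X) (h : PointwiseLeftInvariant P X) (g : SU2) (N : ℕ) :
    IdentDistrib (fun p : Ω × (ℕ → SU2) => sampleCoeffs N p.2 (translate g (X p.1)))
      (fun p => sampleCoeffs N p.2 (X p.1)) (P.prod haarSeq) (P.prod haarSeq) := by
  have h1 := measurable_sampleCoeffs (hX.translate g) N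
  have h2 := measurable_sampleCoeffs hX N
  refine ⟨h1.aemeasurable, h2.aemeasurable, ?_⟩
  ext B hB
  rw [Measure.map_apply h1 hB, Measure.map_apply h2 hB, Measure.prod_apply_symm (h1 hB),
    Measure.prod_apply_symm (h2 hB)]
  refine lintegral_congr fun u => ?_
  have h3 := ((h g).comp (measurable_sampleCoeffs_values N u)).measure_mem_eq hB
  exact h3

theorem IsSquareIntegrableField.map_prod_coeffs [IsProbabilityMeasure P]
    (hX : IsSquareIntegrableField P X) :
    (P.prod haarSeq).map (fun p => coeffs (X p.1)) = P.map fun ω => coeffs (X ω) := by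
  have h1 : (P.prod haarSeq).map Prod.fst = P := by simp
  have h2 := Measure.map_map (μ := P.prod haarSeq) hX.measurable_coeffs measurable_fst
  rw [h1] at h2
  exact h2.symm

theorem PointwiseLeftInvariant.coeffInvariant [IsProbabilityMeasure P]
    (hX : IsSquareIntegrableField P X) (h : PointwiseLeftInvariant P X) : CoeffInvariant P X := by
  intro g
  have h1 := ae_tendsto_sampleCoeffs (hX.translate g)
  have h2 := ae_tendsto_sampleCoeffs hX
  have h3 := h.identDistrib_sampleCoeffs hX g
  have hp := identDistrib_of_tendsto_ae (Z := fun p : Ω × (ℕ → SU2) => coeffs (translate g (X p.1)))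
    (W := fun p : Ω × (ℕ → SU2) => coeffs (X p.1)) h3 h1 h2
  refine ⟨(hX.translate g).measurable_coeffs.aemeasurable, hX.measurable_coeffs.aemeasurable, ?_⟩
  rw [← hX.map_prod_coeffs, ← (hX.translate g).map_prod_coeffs]
  exact hp.map_eq

/-! ### Fields that are continuous in probability -/

theorem measurable_partialSum (hX : IsSquareIntegrableField P X) (N : ℕ) :
    Measurable (Function.uncurry fun ω z => partialSum N (X ω) z) :=
  Finset.measurable_fun_sum _ fun _ _ => ((hX.measurable_coeff _ _ _).comp measurable_fst).mul
    ((continuous_phi _ _ _).measurable.comp measurable_snd)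

/-- The partial sums of the Fourier series converge in measure on `Ω × SU(2)`. -/
theorem tendstoInMeasure_partialSum [IsProbabilityMeasure P] (hX : IsSquareIntegrableField P X) :
    TendstoInMeasure (P.prod vol) (fun N p => partialSum N (X p.1) p.2) atTop
      fun p => X p.1 p.2 := by
  intro ε hε
  have hms : ∀ N, MeasurableSet {p : Ω × SU2 | ε ≤ edist (partialSum N (X p.1) p.2) (X p.1 p.2)} :=
    fun N => measurableSet_le measurable_const
      ((measurable_partialSum hX N).edist hX.measurable)
  refine Tendsto.congr (fun N => (Measure.prod_apply (hms N)).symm) ?_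
  rw [← lintegral_zero (μ := P)]
  -- No moments of `X` are assumed. For almost every `ω`, L² convergence gives convergence in
  -- measure on the group, and the measures of the sections are bounded by the finite total volume.
  refine tendsto_lintegral_of_dominated_convergence (fun _ => vol Set.univ)
    (fun N => measurable_measure_prodMk_left (hms N))
    (fun N => Eventually.of_forall fun ω => measure_mono (Set.subset_univ _)) ?_ ?_
  · rw [lintegral_const]
    exact ENNReal.mul_ne_top (measure_ne_top _ _) (measure_ne_top _ _)
  · filter_upwards [hX.memLp] with ω hω
    have := tendstoInMeasure_of_tendsto_eLpNorm (by simp)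
      (fun N => (continuous_partialSum N (X ω)).aestronglyMeasurable)
      hω.1 (tendsto_eLpNorm_partialSum hω)
    exact this ε hε

theorem tendstoInMeasure_pi {α ι κ : Type*} [MeasurableSpace α] [Fintype ι] {μ : Measure α}
    {f : κ → α → ι → ℂ} {g : α → ι → ℂ} {l : Filter κ}
    (h : ∀ i, TendstoInMeasure μ (fun k ω => f k ω i) l fun ω => g ω i) :
    TendstoInMeasure μ f l g := by
  intro ε hε
  have h1 : Tendsto (fun k => ∑ i, μ {ω | ε ≤ edist (f k ω i) (g ω i)}) l (𝓝 0) := by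
    simpa using tendsto_finsetSum Finset.univ fun i _ => h i ε hε
  refine tendsto_of_tendsto_of_tendsto_of_le_of_le tendsto_const_nhds h1 (fun _ => zero_le) ?_
  intro k
  refine (measure_mono ?_).trans (measure_iUnion_fintype_le μ _)
  intro ω hω
  by_contra hcon
  simp only [Set.mem_iUnion, Set.mem_ofPred_eq, not_exists, not_le] at hcon hω
  refine absurd hω (not_le.mpr ?_)
  rw [edist_pi_def, Finset.sup_lt_iff (by simpa using hε)]
  exact fun i _ => hcon i

theorem IsSquareIntegrableField.measurable_apply (hX : IsSquareIntegrableField P X) (z : SU2) :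
    Measurable fun ω => X ω z := hX.measurable.comp measurable_prodMk_right

theorem CoeffInvariant.identDistrib_of_tendsto [IsProbabilityMeasure P]
    (hX : IsSquareIntegrableField P X) (h : CoeffInvariant P X) (g : SU2) {ι : Type*} [Finite ι]
    (ns : ℕ → ℕ) (v : ι → SU2)
    (hv : ∀ i, ∀ᵐ ω ∂P, Tendsto (fun k => partialSum (ns k) (X ω) (v i)) atTop (𝓝 (X ω (v i))))
    (hv' : ∀ i, ∀ᵐ ω ∂P, Tendsto (fun k => partialSum (ns k) (X ω) (g⁻¹ * v i)) atTop
      (𝓝 (X ω (g⁻¹ * v i)))) :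
    IdentDistrib (fun ω i => X ω (g⁻¹ * v i)) (fun ω i => X ω (v i)) P P := by
  have hm : ∀ N, Measurable fun (c : HarmonicIndex → ℂ) (i : ι) =>
      ∑ j ∈ degreesBelow N, c j * phi j.1 j.2.1 j.2.2 (v i) := fun N =>
    measurable_pi_lambda _ fun i => Finset.measurable_fun_sum _ fun j _ =>
      (measurable_pi_apply _).mul_const _
  have hid : ∀ k, IdentDistrib (fun ω i => partialSum (ns k) (translate g (X ω)) (v i))
      (fun ω i => partialSum (ns k) (X ω) (v i)) P P := fun k => (h g).comp (hm (ns k))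
  refine identDistrib_of_tendsto_ae hid ?_ ?_
  · filter_upwards [ae_all_iff.mpr hv', hX.memLp] with ω hω hL
    refine tendsto_pi_nhds.mpr fun i => (hω i).congr fun k => ?_
    exact (partialSum_translate (ns k) g hL _).symm
  · filter_upwards [ae_all_iff.mpr hv] with ω hω
    exact tendsto_pi_nhds.mpr hω

theorem ContinuousInProbability.tendstoInDistribution [IsProbabilityMeasure P]
    (hX : IsSquareIntegrableField P X) (hc : ContinuousInProbability P X) {ι : Type*} [Fintype ι]
    {u : ℕ → SU2} (hu : Tendsto u atTop (𝓝 1)) (v : ι → SU2) :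
    TendstoInDistribution (fun k ω i => X ω (v i * u k)) atTop (fun ω i => X ω (v i))
      (fun _ => P) P := by
  refine TendstoInMeasure.tendstoInDistribution (tendstoInMeasure_pi fun i => ?_)
    fun k => (measurable_pi_lambda _ fun i => hX.measurable_apply _).aemeasurable
  have h3 : Tendsto (fun k => v i * u k) atTop (𝓝 (v i)) := by
    simpa using hu.const_mul (v i)
  exact (hc (v i)).comp h3

theorem exists_seq_tendsto_partialSum [IsProbabilityMeasure P]
    (hX : IsSquareIntegrableField P X) : ∃ ns : ℕ → ℕ, ∀ᵐ z ∂vol, ∀ᵐ ω ∂P,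
      Tendsto (fun k => partialSum (ns k) (X ω) z) atTop (𝓝 (X ω z)) := by
  obtain ⟨ns, -, hns⟩ := (tendstoInMeasure_partialSum hX).exists_seq_tendsto_ae
  have hswap : ∀ᵐ p ∂vol.prod P,
      Tendsto (fun k => partialSum (ns k) (X p.2) p.1) atTop (𝓝 (X p.2 p.1)) :=
    (Measure.measurePreserving_swap (μ := vol) (ν := P)).quasiMeasurePreserving.ae hns
  exact ⟨ns, Measure.ae_ae_of_ae_prod hswap⟩

/-- Good points, where the partial sums converge almost surely, have full measure, and so has `{u |
x u good}` for each fixed `x`. Hence one right shift `u` serves all the points `v i` and `g⁻¹ v i`;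
being on the right, it does not interfere with the left translation. -/
theorem CoeffInvariant.ae_identDistrib [IsProbabilityMeasure P]
    (hX : IsSquareIntegrableField P X) (h : CoeffInvariant P X) (g : SU2) {ι : Type*} [Fintype ι]
    (v : ι → SU2) : ∀ᵐ u ∂vol,
      IdentDistrib (fun ω i => X ω (g⁻¹ * (v i * u))) (fun ω i => X ω (v i * u)) P P := by
  obtain ⟨ns, hns⟩ := exists_seq_tendsto_partialSum hX
  set G : SU2 → Prop := fun z => ∀ᵐ ω ∂P,
    Tendsto (fun k => partialSum (ns k) (X ω) z) atTop (𝓝 (X ω z)) with hG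
  have hgood : ∀ x : SU2, ∀ᵐ u ∂vol, G (x * u) := fun x =>
    (measurePreserving_mul_left vol x).quasiMeasurePreserving.ae (p := G) hns
  have h2 : ∀ᵐ u ∂vol, ∀ i, G (v i * u) := ae_all_iff.mpr fun i => hgood (v i)
  have h3 : ∀ᵐ u ∂vol, ∀ i, G (g⁻¹ * v i * u) := ae_all_iff.mpr fun i => hgood (g⁻¹ * v i)
  filter_upwards [h2, h3] with u hu hu'
  exact h.identDistrib_of_tendsto hX g ns (fun i => v i * u) hu
    fun i => (mul_assoc g⁻¹ (v i) u) ▸ hu' i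

/-- A set of full measure is dense, so admissible shifts tend to `1`, and continuity in probability
passes to the limit in law. -/
theorem CoeffInvariant.identDistrib_values [IsProbabilityMeasure P]
    (hX : IsSquareIntegrableField P X) (hc : ContinuousInProbability P X)
    (h : CoeffInvariant P X) (g : SU2) {ι : Type*} [Fintype ι] (v : ι → SU2) :
    IdentDistrib (fun ω i => X ω (g⁻¹ * v i)) (fun ω i => X ω (v i)) P P := by
  have hd := Measure.dense_of_ae (h.ae_identDistrib hX g v)
  obtain ⟨u, hu, hu1⟩ := mem_closure_iff_seq_limit.mp (hd 1)
  have h5 := hc.tendstoInDistribution hX hu1 fun i => g⁻¹ * v i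
  simp only [mul_assoc] at h5
  exact identDistrib_of_tendstoInDistribution hu h5 (hc.tendstoInDistribution hX hu1 v)

theorem CoeffInvariant.pointwiseLeftInvariant [IsProbabilityMeasure P]
    (hX : IsSquareIntegrableField P X) (hc : ContinuousInProbability P X)
    (h : CoeffInvariant P X) : PointwiseLeftInvariant P X := by
  intro g
  refine (identDistrib_iff_forall_finset_identDistrib
    (X := fun (p : Unit × SU2) ω => X ω (g⁻¹ * p.2)) (Y := fun (p : Unit × SU2) ω => X ω p.2)
    (measurable_pi_lambda _ fun p : Unit × SU2 => hX.measurable_apply _).aemeasurable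
    (measurable_pi_lambda _ fun p : Unit × SU2 => hX.measurable_apply _).aemeasurable).mpr ?_
  intro I
  exact h.identDistrib_values hX hc g fun p : I => p.1.2

end

/-! ### Norms of finite expansions -/

theorem coeff_phi_index (i j : HarmonicIndex) :
    coeff i.1 i.2.1 i.2.2 (phi j.1 j.2.1 j.2.2) = if i = j then 1 else 0 := by
  rw [← inner_phiL2_toL2 i (memLp_of_continuous (continuous_phi _ _ _) 2), ← phiL2_eq_toL2,
    orthonormal_iff_ite.mp orthonormal_phiL2]

theorem integral_norm_sq_sum {ι : Type*} [Fintype ι] {e : ι → HarmonicIndex}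
    (he : Function.Injective e) (c : ι → ℂ) :
    ∫ z, ‖∑ k, c k * phi (e k).1 (e k).2.1 (e k).2.2 z‖ ^ 2 ∂vol = ∑ k, ‖c k‖ ^ 2 := by
  set f : SU2 → ℂ := fun z => ∑ k, c k * phi (e k).1 (e k).2.1 (e k).2.2 z with hf
  have hfc : Continuous f :=
    continuous_finsetSum _ fun k _ => continuous_const.mul (continuous_phi _ _ _)
  have hcoeff : ∀ k, coeff (e k).1 (e k).2.1 (e k).2.2 f = c k := by
    classical
    intro k
    rw [hf, coeff_sum _ _ (fun j => phi (e j).1 (e j).2.1 (e j).2.2)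
      fun j => continuous_phi _ _ _]
    simp [coeff_phi_index, he.eq_iff]
  apply Complex.ofReal_injective
  rw [← integral_complex_ofReal]
  have h1 : ∀ z, ((‖f z‖ ^ 2 : ℝ) : ℂ) =
      ∑ k, conj (c k) * (conj (phi (e k).1 (e k).2.1 (e k).2.2 z) * f z) := by
    intro z
    push_cast
    rw [← Complex.conj_mul']
    conv_lhs => rw [hf]
    simp only [map_sum, map_mul, Finset.sum_mul]
    exact Finset.sum_congr rfl fun k _ => by rw [mul_assoc]
  refine (integral_congr_ae (Eventually.of_forall h1)).trans ?_
  rw [integral_finsetSum _ fun k _ =>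
    (integrable_conj_phi_mul _ _ _ (memLp_of_continuous hfc 2)).const_mul _]
  push_cast
  refine Finset.sum_congr rfl fun k _ => ?_
  rw [integral_const_mul]
  refine (congrArg (conj (c k) * ·) (hcoeff k)).trans ?_
  exact Complex.conj_mul' (c k)

theorem eLpNorm_two_sq {α : Type*} [MeasurableSpace α] {μ : Measure α} (f : α → ℂ) :
    eLpNorm f 2 μ ^ 2 = ∫⁻ z, ‖f z‖ₑ ^ 2 ∂μ := by
  have := eLpNorm_nnreal_pow_eq_lintegral (f := f) (μ := μ) (p := 2) (by norm_num)
  simpa using this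

theorem eLpNorm_sq_sum {ι : Type*} [Fintype ι] {e : ι → HarmonicIndex}
    (he : Function.Injective e) (c : ι → ℂ) :
    eLpNorm (fun z => ∑ k, c k * phi (e k).1 (e k).2.1 (e k).2.2 z) 2 vol ^ 2 =
      ∑ k, ‖c k‖ₑ ^ 2 := by
  have hfc : Continuous fun z => ∑ k, c k * phi (e k).1 (e k).2.1 (e k).2.2 z :=
    continuous_finsetSum _ fun k _ => continuous_const.mul (continuous_phi _ _ _)
  rw [eLpNorm_two_sq]
  have h1 : ∀ w : ℂ, ‖w‖ₑ ^ 2 = ENNReal.ofReal (‖w‖ ^ 2) := by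
    intro w
    rw [ENNReal.ofReal_pow (norm_nonneg _), ofReal_norm]
  simp_rw [h1]
  rw [← ofReal_integral_eq_lintegral_ofReal
    ((memLp_two_iff_integrable_sq_norm hfc.aestronglyMeasurable).mp (memLp_of_continuous hfc 2))
    (Eventually.of_forall fun z => by positivity), integral_norm_sq_sum he,
    ENNReal.ofReal_sum_of_nonneg fun k _ => by positivity]

theorem injective_column_index (n : ℕ) (s : Fin (n + 1)) :
    Function.Injective fun m : Fin (n + 1) => (⟨n, m, s⟩ : HarmonicIndex) := by
  intro m m' h
  simpa using h

theorem integral_norm_sq_column (n : ℕ) (s : Fin (n + 1)) (F : SU2 → ℂ) :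
    ∫ z, ‖column n s F z‖ ^ 2 ∂vol = ∑ m, ‖coeff n m s F‖ ^ 2 :=
  integral_norm_sq_sum (injective_column_index n s) _

theorem eLpNorm_sq_column (n : ℕ) (s : Fin (n + 1)) (F : SU2 → ℂ) :
    eLpNorm (column n s F) 2 vol ^ 2 = ∑ m, ‖coeff n m s F‖ₑ ^ 2 :=
  eLpNorm_sq_sum (injective_column_index n s) _

section

variable {Ω : Type*} [MeasurableSpace Ω] {P : Measure Ω} {X : Ω → SU2 → ℂ}

/-! ### Correlations -/

/-- By Parseval, one coefficient is dominated by the norm of its column. -/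
theorem memLp_coeff (hX : IsSquareIntegrableField P X) {n : ℕ} {s : Fin (n + 1)}
    (h : secondMoment P (columns X ⟨n, s⟩) < ∞) (m : Fin (n + 1)) :
    MemLp (fun ω => coeff n m s (X ω)) 2 P := by
  refine ⟨(hX.measurable_coeff n m s).aestronglyMeasurable, ?_⟩
  have h1 : eLpNorm (fun ω => coeff n m s (X ω)) 2 P ^ 2 < ∞ := by
    rw [eLpNorm_two_sq]
    refine lt_of_le_of_lt (lintegral_mono fun ω => ?_) h
    change _ ≤ eLpNorm (column n s (X ω)) 2 vol ^ 2
    rw [eLpNorm_sq_column]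
    exact Finset.single_le_sum (f := fun m => ‖coeff n m s (X ω)‖ₑ ^ 2)
      (fun _ _ => zero_le) (Finset.mem_univ m)
  exact (ENNReal.pow_lt_top_iff.mp h1).resolve_right (by norm_num)

/-- Common source of the mean, covariance and pseudo-covariance formulas: invariance in law of the
product `u v`, expanded bilinearly. -/
theorem CoeffInvariant.intertwines (h : CoeffInvariant P X) {n n' : ℕ}
    {u : Fin (n + 1) → (HarmonicIndex → ℂ) → ℂ} {v : Fin (n' + 1) → (HarmonicIndex → ℂ) → ℂ}
    (hu : ∀ m, Measurable (u m)) (hv : ∀ m, Measurable (v m))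
    (hug : ∀ g m, ∀ᵐ ω ∂P, u m (coeffs (translate g (X ω))) =
      ∑ k, wignerD n m k g * u k (coeffs (X ω)))
    (hvg : ∀ g m, ∀ᵐ ω ∂P, v m (coeffs (translate g (X ω))) =
      ∑ k, conj (wignerD n' m k g) * v k (coeffs (X ω)))
    (hi : ∀ m m', Integrable (fun ω => u m (coeffs (X ω)) * v m' (coeffs (X ω))) P) :
    Intertwines n n' fun m m' => ∫ ω, u m (coeffs (X ω)) * v m' (coeffs (X ω)) ∂P := by
  intro g m m'
  have h1 := ((h g).comp ((hu m).mul (hv m'))).integral_eq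
  refine h1.symm.trans ?_
  simp_rw [← integral_const_mul]
  simp_rw [← integral_finsetSum _ fun k' _ => (hi _ k').const_mul _]
  rw [← integral_finsetSum _ fun k _ => integrable_finsetSum _ fun k' _ =>
    (hi k k').const_mul _]
  refine integral_congr_ae ?_
  filter_upwards [hug g m, hvg g m'] with ω h2 h3
  change u m (coeffs (translate g (X ω))) * v m' (coeffs (translate g (X ω))) = _
  rw [h2, h3, Finset.sum_mul_sum]
  exact Finset.sum_congr rfl fun k _ => Finset.sum_congr rfl fun k' _ => by ring

theorem CoeffInvariant.intertwines_conj (hX : IsSquareIntegrableField P X)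
    (h : CoeffInvariant P X) {n n' : ℕ} {s : Fin (n + 1)} {s' : Fin (n' + 1)}
    (hs : secondMoment P (columns X ⟨n, s⟩) < ∞)
    (hs' : secondMoment P (columns X ⟨n', s'⟩) < ∞) :
    Intertwines n n' fun m m' => ∫ ω, conj (coeff n m s (X ω)) * coeff n' m' s' (X ω) ∂P := by
  refine h.intertwines (u := fun m c => conj (c ⟨n, m, s⟩)) (v := fun m c => c ⟨n', m, s'⟩)
    (fun m => Complex.continuous_conj.measurable.comp (measurable_pi_apply _))
    (fun m => measurable_pi_apply _) (fun g m => ?_) (fun g m => ?_) fun m m' => ?_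
  · filter_upwards [hX.memLp] with ω hω
    simp only [coeffs]
    rw [coeff_translate n m s g hω]
    simp
  · filter_upwards [hX.memLp] with ω hω
    exact coeff_translate n' m s' g hω
  · exact (memLp_coeff hX hs m).star.integrable_mul (memLp_coeff hX hs' m')

/-- By self-duality, the signed and reversed coefficients transform by `D` instead of `conj D`, so
no conjugation is needed. -/
theorem CoeffInvariant.intertwines_pseudo (hX : IsSquareIntegrableField P X)
    (h : CoeffInvariant P X) {n n' : ℕ} {s : Fin (n + 1)} {s' : Fin (n' + 1)}
    (hs : secondMoment P (columns X ⟨n, s⟩) < ∞)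
    (hs' : secondMoment P (columns X ⟨n', s'⟩) < ∞) :
    Intertwines n n' fun m m' =>
      ∫ ω, (-1) ^ (n - m : ℕ) * coeff n m.rev s (X ω) * coeff n' m' s' (X ω) ∂P := by
  refine h.intertwines (u := fun m c => (-1) ^ (n - m : ℕ) * c ⟨n, m.rev, s⟩)
    (v := fun m c => c ⟨n', m, s'⟩)
    (fun m => (measurable_pi_apply _).const_mul _)
    (fun m => measurable_pi_apply _) (fun g m => ?_) (fun g m => ?_) fun m m' => ?_
  · filter_upwards [hX.memLp] with ω hω
    simp only [coeffs]
    rw [coeff_translate n m.rev s g hω, ← Equiv.sum_comp Fin.revPerm, Finset.mul_sum]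
    refine Finset.sum_congr rfl fun k _ => ?_
    rw [Fin.revPerm_apply, conj_wignerD, Fin.rev_rev, Fin.rev_rev]
    have h1 : n - (m.rev : ℕ) = m := by rw [Fin.val_rev]; omega
    have h2 : n - (k.rev : ℕ) = k := by rw [Fin.val_rev]; omega
    have h3 : (-1 : ℂ) ^ (n - m : ℕ) * (-1) ^ (m : ℕ) = (-1) ^ (n - k : ℕ) * (-1) ^ (k : ℕ) := by
      rw [← pow_add, ← pow_add]
      congr 1
      omega
    have h4 : (-1 : ℂ) ^ (k : ℕ) * (-1) ^ (k : ℕ) = 1 := by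
      rw [← mul_pow]; simp
    rw [h1, h2]
    linear_combination (-1) ^ (k : ℕ) * wignerD n m k g * coeff n k.rev s (X ω) * h3 +
      (-1) ^ (n - k : ℕ) * wignerD n m k g * coeff n k.rev s (X ω) * h4
  · filter_upwards [hX.memLp] with ω hω
    exact coeff_translate n' m s' g hω
  · have := ((memLp_coeff hX hs m.rev).integrable_mul (memLp_coeff hX hs' m')).const_mul
      ((-1 : ℂ) ^ (n - m : ℕ))
    refine this.congr (Eventually.of_forall fun ω => ?_)
    simp only [coeffs, Pi.mul_apply]
    ring

/-- The mean intertwines degree `n` with the trivial representation, which is degree `0`. -/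
theorem CoeffInvariant.integral_coeff_eq_zero [IsProbabilityMeasure P]
    (hX : IsSquareIntegrableField P X)
    (h : CoeffInvariant P X) {n : ℕ} (hn : n ≠ 0) {s : Fin (n + 1)}
    (hs : secondMoment P (columns X ⟨n, s⟩) < ∞) (m : Fin (n + 1)) :
    ∫ ω, coeff n m s (X ω) ∂P = 0 := by
  have hI : Intertwines n 0 fun m _ => ∫ ω, conj (coeff n m s (X ω)) * 1 ∂P := by
    refine h.intertwines (u := fun m c => conj (c ⟨n, m, s⟩)) (v := fun _ _ => 1)
      (fun m => Complex.continuous_conj.measurable.comp (measurable_pi_apply _))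
      (fun m => measurable_const) (fun g m => ?_) (fun g m => ?_) fun m m' => ?_
    · filter_upwards [hX.memLp] with ω hω
      simp only [coeffs]
      rw [coeff_translate n m s g hω]
      simp
    · refine Eventually.of_forall fun ω => ?_
      have hm : m = 0 := Fin.ext (by omega)
      subst hm
      simp [wignerD]
    · exact ((memLp_coeff hX hs m).star.integrable one_le_two).mul_const _
  have h1 := hI.eq_zero_of_ne hn m 0
  simp only [mul_one] at h1
  rw [integral_conj] at h1
  simpa using h1

theorem CoeffInvariant.integral_conj_mul_of_ne (hX : IsSquareIntegrableField P X)
    (h : CoeffInvariant P X) {n n' : ℕ} (hn : n ≠ n') {s : Fin (n + 1)} {s' : Fin (n' + 1)}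
    (hs : secondMoment P (columns X ⟨n, s⟩) < ∞)
    (hs' : secondMoment P (columns X ⟨n', s'⟩) < ∞) (m : Fin (n + 1)) (m' : Fin (n' + 1)) :
    ∫ ω, conj (coeff n m s (X ω)) * coeff n' m' s' (X ω) ∂P = 0 :=
  (h.intertwines_conj hX hs hs').eq_zero_of_ne hn m m'

theorem CoeffInvariant.integral_mul_of_ne (hX : IsSquareIntegrableField P X)
    (h : CoeffInvariant P X) {n n' : ℕ} (hn : n ≠ n') {s : Fin (n + 1)} {s' : Fin (n' + 1)}
    (hs : secondMoment P (columns X ⟨n, s⟩) < ∞)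
    (hs' : secondMoment P (columns X ⟨n', s'⟩) < ∞) (m : Fin (n + 1)) (m' : Fin (n' + 1)) :
    ∫ ω, coeff n m s (X ω) * coeff n' m' s' (X ω) ∂P = 0 := by
  have h1 := (h.intertwines_pseudo hX hs hs').eq_zero_of_ne hn m.rev m'
  simp only [Fin.rev_rev, mul_assoc] at h1
  rw [integral_const_mul] at h1
  exact (mul_eq_zero.mp h1).resolve_left (pow_ne_zero _ (by norm_num))

theorem CoeffInvariant.integral_conj_mul (hX : IsSquareIntegrableField P X)
    (h : CoeffInvariant P X) {n : ℕ} {s s' : Fin (n + 1)}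
    (hs : secondMoment P (columns X ⟨n, s⟩) < ∞)
    (hs' : secondMoment P (columns X ⟨n, s'⟩) < ∞) (m m' : Fin (n + 1)) :
    ∫ ω, conj (coeff n m s (X ω)) * coeff n m' s' (X ω) ∂P =
      (if m' = m then 1 / (n + 1 : ℂ) else 0) *
        ∑ k, ∫ ω, conj (coeff n k s (X ω)) * coeff n k s' (X ω) ∂P :=
  (h.intertwines_conj hX hs hs').eq_trace m m'

theorem CoeffInvariant.integral_mul (hX : IsSquareIntegrableField P X)
    (h : CoeffInvariant P X) {n : ℕ} {s s' : Fin (n + 1)}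
    (hs : secondMoment P (columns X ⟨n, s⟩) < ∞)
    (hs' : secondMoment P (columns X ⟨n, s'⟩) < ∞) (m m' : Fin (n + 1)) :
    ∫ ω, coeff n m s (X ω) * coeff n m' s' (X ω) ∂P =
      (if m' = m.rev then (-1) ^ (n - m : ℕ) / (n + 1 : ℂ) else 0) *
        ∑ k : Fin (n + 1), (-1) ^ (n - k : ℕ) *
          ∫ ω, coeff n k s (X ω) * coeff n k.rev s' (X ω) ∂P := by
  have h1 := (h.intertwines_pseudo hX hs hs').eq_trace m.rev m'
  simp only [mul_assoc, integral_const_mul, Fin.rev_rev] at h1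
  rw [← Equiv.sum_comp Fin.revPerm] at h1
  simp only [Fin.revPerm_apply, Fin.rev_rev] at h1
  have hr : ∀ k : Fin (n + 1), n - (k.rev : ℕ) = k := fun k => by rw [Fin.val_rev]; omega
  simp only [hr] at h1
  have hq : ∀ k : Fin (n + 1), (-1 : ℂ) ^ (k : ℕ) * (-1) ^ (k : ℕ) = 1 := fun k => by
    rw [← mul_pow]; simp
  have hs : ∀ k : Fin (n + 1), (-1 : ℂ) ^ (n - k : ℕ) = (-1) ^ n * (-1) ^ (k : ℕ) := by
    intro k
    have : (-1 : ℂ) ^ n = (-1) ^ (n - k : ℕ) * (-1) ^ (k : ℕ) := by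
      rw [← pow_add]
      congr 1
      omega
    rw [this, mul_assoc, hq, mul_one]
  -- Schur's lemma at the reversed index gives signs `(-1) ^ m`, the claim has `(-1) ^ (n - m)`; the
  -- discrepancy `(-1) ^ n` occurs once outside and once inside the sum.
  have hn : (-1 : ℂ) ^ n * (-1) ^ n = 1 := by rw [← mul_pow]; simp
  simp only [hs, mul_assoc, ← Finset.mul_sum]
  have h2 : ∀ w : ℂ, w = (-1) ^ (m : ℕ) * ((-1) ^ (m : ℕ) * w) := fun w => by
    rw [← mul_assoc, hq, one_mul]
  refine (h2 _).trans ?_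
  rw [h1]
  split_ifs
  · linear_combination (-((-1) ^ (m : ℕ) / (n + 1 : ℂ) * ∑ k : Fin (n + 1), (-1) ^ (k : ℕ) *
      ∫ ω, coeff n k s (X ω) * coeff n k.rev s' (X ω) ∂P)) * hn
  · ring

theorem CoeffInvariant.integral_norm_sq (hX : IsSquareIntegrableField P X)
    (h : CoeffInvariant P X) {n : ℕ} {s : Fin (n + 1)}
    (hs : secondMoment P (columns X ⟨n, s⟩) < ∞) (m : Fin (n + 1)) :
    ∫ ω, ‖coeff n m s (X ω)‖ ^ 2 ∂P =
      (1 / (n + 1 : ℝ)) * ∫ ω, ∫ g, ‖column n s (X ω) g‖ ^ 2 ∂vol ∂P := by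
  have hi : ∀ k, Integrable (fun ω => ‖coeff n k s (X ω)‖ ^ 2) P := fun k =>
    (memLp_two_iff_integrable_sq_norm (hX.measurable_coeff n k s).aestronglyMeasurable).mp
      (memLp_coeff hX hs k)
  simp_rw [integral_norm_sq_column]
  rw [integral_finsetSum _ fun k _ => hi k]
  have h1 := h.integral_conj_mul hX hs hs m m
  simp only [if_true, Complex.conj_mul'] at h1
  apply Complex.ofReal_injective
  push_cast
  simp_rw [← integral_complex_ofReal]
  push_cast
  exact h1

theorem cov_eq [IsProbabilityMeasure P] {U V : Ω → ℂ} (hU : MemLp U 2 P) (hV : MemLp V 2 P) :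
    cov P U V = ∫ ω, conj (U ω) * V ω ∂P - conj (∫ ω, U ω ∂P) * ∫ ω, V ω ∂P := by
  have hU1 : Integrable (fun ω => conj (U ω)) P := hU.star.integrable one_le_two
  have hV1 := hV.integrable one_le_two
  have hUV : Integrable (fun ω => conj (U ω) * V ω) P := hU.star.integrable_mul hV
  have hc := integral_conj (μ := P) (f := U)
  rw [cov]
  set a := ∫ ω, U ω ∂P
  set b := ∫ ω, V ω ∂P with hb
  have : ∀ ω, conj (U ω - a) * (V ω - b) =
      conj (U ω) * V ω - conj (U ω) * b - (conj a * V ω - conj a * b) := by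
    intro ω
    rw [map_sub]
    ring
  simp_rw [this]
  have hs : ∫ ω, conj (U ω) * V ω - conj (U ω) * b - (conj a * V ω - conj a * b) ∂P =
      (∫ ω, conj (U ω) * V ω - conj (U ω) * b ∂P) - ∫ ω, conj a * V ω - conj a * b ∂P :=
    integral_sub (hUV.sub (hU1.mul_const b)) ((hV1.const_mul _).sub (integrable_const _))
  rw [hs, integral_sub hUV (hU1.mul_const b), integral_sub (hV1.const_mul _) (integrable_const _),
    integral_mul_const, integral_const_mul, integral_const, hc, ← hb]
  simp

theorem memLp_column (hX : IsSquareIntegrableField P X) {n : ℕ} {s : Fin (n + 1)}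
    (hs : secondMoment P (columns X ⟨n, s⟩) < ∞) (z : SU2) :
    MemLp (fun ω => columns X ⟨n, s⟩ ω z) 2 P :=
  memLp_finsetSum Finset.univ fun m _ => (memLp_coeff hX hs m).mul_const _

theorem CoeffInvariant.integral_column_eq_zero [IsProbabilityMeasure P]
    (hX : IsSquareIntegrableField P X)
    (h : CoeffInvariant P X) {n : ℕ} (hn : n ≠ 0) {s : Fin (n + 1)}
    (hs : secondMoment P (columns X ⟨n, s⟩) < ∞) (z : SU2) :
    ∫ ω, columns X ⟨n, s⟩ ω z ∂P = 0 := by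
  simp only [columns, column]
  rw [integral_finsetSum _ fun m _ => ((memLp_coeff hX hs m).integrable one_le_two).mul_const _]
  simp [integral_mul_const, h.integral_coeff_eq_zero hX hn hs]

theorem CoeffInvariant.uncorrelated [IsProbabilityMeasure P] (hX : IsSquareIntegrableField P X)
    (h : CoeffInvariant P X) {n n' : ℕ} (hn : n ≠ n') {s : Fin (n + 1)} {s' : Fin (n' + 1)}
    (hs : secondMoment P (columns X ⟨n, s⟩) < ∞)
    (hs' : secondMoment P (columns X ⟨n', s'⟩) < ∞) :
    Uncorrelated P (columns X ⟨n, s⟩) (columns X ⟨n', s'⟩) := by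
  intro y z
  have hU := memLp_column hX hs y
  have hV := memLp_column hX hs' z
  -- Two different degrees are not both zero, so the product of means drops out.
  have hmean : (∫ ω, columns X ⟨n, s⟩ ω y ∂P) = 0 ∨ (∫ ω, columns X ⟨n', s'⟩ ω z ∂P) = 0 := by
    by_cases h0 : n = 0
    · exact Or.inr (h.integral_column_eq_zero hX (by omega) hs' z)
    · exact Or.inl (h.integral_column_eq_zero hX h0 hs y)
  constructor
  · rw [cov_eq hU hV]
    have h1 : ∫ ω, conj (columns X ⟨n, s⟩ ω y) * columns X ⟨n', s'⟩ ω z ∂P = 0 := by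
      have h2 : ∀ ω, conj (columns X ⟨n, s⟩ ω y) * columns X ⟨n', s'⟩ ω z =
          ∑ m, ∑ m', (conj (phi n m s y) * phi n' m' s' z) *
            (conj (coeff n m s (X ω)) * coeff n' m' s' (X ω)) := by
        intro ω
        simp only [columns, column, map_sum, map_mul, Finset.sum_mul_sum]
        exact Finset.sum_congr rfl fun m _ => Finset.sum_congr rfl fun m' _ => by ring
      have hi : ∀ m m', Integrable (fun ω => (conj (phi n m s y) * phi n' m' s' z) *
            (conj (coeff n m s (X ω)) * coeff n' m' s' (X ω))) P := fun m m' =>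
        ((memLp_coeff hX hs m).star.integrable_mul (memLp_coeff hX hs' m')).const_mul _
      simp_rw [h2]
      rw [integral_finsetSum _ fun m _ => integrable_finsetSum _ fun m' _ => hi m m']
      simp_rw [fun m => integral_finsetSum Finset.univ fun m' _ => hi m m', integral_const_mul,
        h.integral_conj_mul_of_ne hX hn hs hs']
      simp
    rw [h1]
    rcases hmean with h0 | h0 <;> simp [h0]
  · have hcU : MemLp (fun ω => conj (columns X ⟨n, s⟩ ω y)) 2 P := hU.star
    rw [cov_eq hcU hV, integral_conj]
    simp only [Complex.conj_conj]
    have h1 : ∫ ω, columns X ⟨n, s⟩ ω y * columns X ⟨n', s'⟩ ω z ∂P = 0 := by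
      have h2 : ∀ ω, columns X ⟨n, s⟩ ω y * columns X ⟨n', s'⟩ ω z =
          ∑ m, ∑ m', (phi n m s y * phi n' m' s' z) *
            (coeff n m s (X ω) * coeff n' m' s' (X ω)) := by
        intro ω
        simp only [columns, column, Finset.sum_mul_sum]
        exact Finset.sum_congr rfl fun m _ => Finset.sum_congr rfl fun m' _ => by ring
      have hi : ∀ m m', Integrable (fun ω => (phi n m s y * phi n' m' s' z) *
            (coeff n m s (X ω) * coeff n' m' s' (X ω))) P := fun m m' =>
        ((memLp_coeff hX hs m).integrable_mul (memLp_coeff hX hs' m')).const_mul _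
      simp_rw [h2]
      rw [integral_finsetSum _ fun m _ => integrable_finsetSum _ fun m' _ => hi m m']
      simp_rw [fun m => integral_finsetSum Finset.univ fun m' _ => hi m m', integral_const_mul,
        h.integral_mul_of_ne hX hn hs hs']
      simp
    rw [h1]
    rcases hmean with h0 | h0 <;> simp [h0]

end

/-! ### Randomly rotated harmonics -/

/-- The uniform sign. -/
def coin : Measure Bool := (2⁻¹ : ℝ≥0∞) • (Measure.dirac true + Measure.dirac false)

instance : IsProbabilityMeasure coin := ⟨by
  simp only [coin, Measure.smul_apply, Measure.add_apply, measure_univ, smul_eq_mul]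
  rw [one_add_one_eq_two, ENNReal.inv_mul_cancel (by norm_num) (by norm_num)]⟩

/-- The value `±1` of a coin. -/
def sign (b : Bool) : ℂ := if b then 1 else -1

theorem sign_mul_self (b : Bool) : sign b * sign b = 1 := by cases b <;> simp [sign]

theorem conj_sign (b : Bool) : conj (sign b) = sign b := by cases b <;> simp [sign]

theorem enorm_sign (b : Bool) : ‖sign b‖ₑ = 1 := by cases b <;> simp [sign]

theorem integral_sign : ∫ b, sign b ∂coin = 0 := by
  rw [coin, integral_smul_measure, integral_add_measure
    (Integrable.of_finite) (Integrable.of_finite), integral_dirac, integral_dirac]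
  simp [sign]

/-- The random field `± ∑ₜ yₜ φ_{0,t}(h⁻¹ z)` with a random sign and a random rotation `h`. -/
def rotatedField (n : ℕ) (y : Fin (n + 1) → ℂ) (ω : SU2 × Bool) (z : SU2) : ℂ :=
  ∑ t, sign ω.2 * y t * phi n 0 t (ω.1⁻¹ * z)

/-- The law of the random rotation and the random sign. -/
def rotationLaw : Measure (SU2 × Bool) := haar.prod coin

instance : IsProbabilityMeasure rotationLaw := by unfold rotationLaw; infer_instance

section

variable (n : ℕ) (y : Fin (n + 1) → ℂ)

theorem measurable_rotatedField : Measurable (Function.uncurry (rotatedField n y)) := by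
  have hs : Measurable sign := measurable_from_top
  have hs' : Measurable fun p : (SU2 × Bool) × SU2 => sign p.1.2 :=
    hs.comp (measurable_snd.comp measurable_fst)
  have hh : Measurable fun p : (SU2 × Bool) × SU2 => p.1.1⁻¹ * p.2 :=
    (measurable_inv.comp (measurable_fst.comp measurable_fst)).mul measurable_snd
  change Measurable fun p : (SU2 × Bool) × SU2 =>
    ∑ t, sign p.1.2 * y t * phi n 0 t (p.1.1⁻¹ * p.2)
  refine Finset.measurable_fun_sum _ fun t _ => Measurable.mul ?_ ?_
  · exact hs'.mul_const _
  · exact (continuous_phi n 0 t).measurable.comp hh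

theorem continuous_rotatedField (ω : SU2 × Bool) : Continuous (rotatedField n y ω) :=
  continuous_finsetSum _ fun t _ => continuous_const.mul
    ((continuous_phi n 0 t).comp (continuous_const_mul _))

theorem isSquareIntegrableField_rotatedField :
    IsSquareIntegrableField rotationLaw (rotatedField n y) where
  measurable := measurable_rotatedField n y
  memLp := Eventually.of_forall fun ω => memLp_of_continuous (continuous_rotatedField n y ω) 2

/-- Translating by `g` replaces the rotation `h` by `g h`, which has the same Haar law. -/
theorem pointwiseLeftInvariant_rotatedField :
    PointwiseLeftInvariant rotationLaw (rotatedField n y) := by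
  intro g
  have hT : MeasurePreserving (fun ω : SU2 × Bool => (g * ω.1, ω.2)) rotationLaw rotationLaw :=
    (measurePreserving_mul_left haar g).prod (MeasurePreserving.id coin)
  have hm : Measurable fun (ω : SU2 × Bool) (p : Unit × SU2) => rotatedField n y ω p.2 :=
    measurable_pi_lambda _ fun p =>
      (isSquareIntegrableField_rotatedField n y).measurable_apply p.2
  have he : (fun (ω : SU2 × Bool) (p : Unit × SU2) => rotatedField n y ω (g⁻¹ * p.2)) =
      (fun (ω : SU2 × Bool) (p : Unit × SU2) => rotatedField n y ω p.2) ∘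
        fun ω => (g * ω.1, ω.2) := by
    funext ω p
    simp only [Function.comp_apply, rotatedField, mul_inv_rev, mul_assoc]
  change IdentDistrib (fun (ω : SU2 × Bool) (p : Unit × SU2) => rotatedField n y ω (g⁻¹ * p.2))
    (fun (ω : SU2 × Bool) (p : Unit × SU2) => rotatedField n y ω p.2) rotationLaw rotationLaw
  rw [he]
  refine ⟨(hm.comp hT.measurable).aemeasurable, hm.aemeasurable, ?_⟩
  rw [← Measure.map_map hm hT.measurable, hT.map_eq]

theorem leftInvariant_rotatedField : LeftInvariant rotationLaw (rotatedField n y) :=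
  ((pointwiseLeftInvariant_rotatedField n y).coeffInvariant
    (isSquareIntegrableField_rotatedField n y)).leftInvariant
    (isSquareIntegrableField_rotatedField n y)

theorem rotatedField_eq (ω : SU2 × Bool) (z : SU2) : rotatedField n y ω z =
    ∑ i : Fin (n + 1) × Fin (n + 1), (sign ω.2 * y i.2 * conj (wignerD n i.1 0 ω.1)) *
      phi n i.1 i.2 z := by
  rw [rotatedField, Fintype.sum_prod_type_right]
  refine Finset.sum_congr rfl fun t _ => ?_
  rw [phi_mul, Finset.mul_sum]
  refine Finset.sum_congr rfl fun k _ => ?_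
  rw [wignerD_inv]
  ring

theorem coeff_rotatedField (ω : SU2 × Bool) (m t : Fin (n + 1)) :
    coeff n m t (rotatedField n y ω) = sign ω.2 * y t * conj (wignerD n m 0 ω.1) := by
  rw [funext (rotatedField_eq n y ω), coeff_sum Finset.univ
    (fun i : Fin (n + 1) × Fin (n + 1) => sign ω.2 * y i.2 * conj (wignerD n i.1 0 ω.1))
    (fun i => phi n i.1 i.2) fun i => continuous_phi _ _ _, Fintype.sum_prod_type]
  simp only [coeff_phi, ite_and]
  simp

theorem coeff_rotatedField_of_ne {n' : ℕ} (hn : n' ≠ n) (ω : SU2 × Bool) (m t : Fin (n' + 1)) :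
    coeff n' m t (rotatedField n y ω) = 0 := by
  rw [funext (rotatedField_eq n y ω), coeff_sum Finset.univ
    (fun i : Fin (n + 1) × Fin (n + 1) => sign ω.2 * y i.2 * conj (wignerD n i.1 0 ω.1))
    (fun i => phi n i.1 i.2) fun i => continuous_phi _ _ _]
  simp [coeff_phi_of_ne hn]

theorem column_rotatedField (ω : SU2 × Bool) (t : Fin (n + 1)) (z : SU2) :
    column n t (rotatedField n y ω) z = sign ω.2 * y t * phi n 0 t (ω.1⁻¹ * z) := by
  simp only [column, coeff_rotatedField]
  rw [phi_mul, Finset.mul_sum]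
  refine Finset.sum_congr rfl fun k _ => ?_
  rw [wignerD_inv]
  ring

theorem rotatedField_eq_degreePart (ω : SU2 × Bool) :
    rotatedField n y ω = degreePart n (rotatedField n y ω) := by
  funext z
  simp only [degreePart, column_rotatedField]
  rfl

theorem sum_enorm_sq_wignerD (h : SU2) : ∑ m, ‖wignerD n m 0 h‖ₑ ^ 2 = 1 := by
  have h1 := sum_conj_wignerD_mul n 0 0 h
  simp only [Complex.conj_mul', if_true] at h1
  have h2 : ∑ m, ‖wignerD n m 0 h‖ ^ 2 = 1 := by exact_mod_cast h1
  have h3 : ∀ w : ℂ, ‖w‖ₑ ^ 2 = ENNReal.ofReal (‖w‖ ^ 2) := by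
    intro w
    rw [ENNReal.ofReal_pow (norm_nonneg _), ofReal_norm]
  simp_rw [h3]
  rw [← ENNReal.ofReal_sum_of_nonneg fun _ _ => by positivity, h2, ENNReal.ofReal_one]

theorem enorm_coeff_rotatedField (ω : SU2 × Bool) (m t : Fin (n + 1)) :
    ‖sign ω.2 * y t * conj (wignerD n m 0 ω.1)‖ₑ ^ 2 =
      ‖y t‖ₑ ^ 2 * ‖wignerD n m 0 ω.1‖ₑ ^ 2 := by
  rw [enorm_mul, enorm_mul, enorm_sign, one_mul, mul_pow]
  rw [← ofReal_norm (conj (wignerD n m 0 ω.1)), RCLike.norm_conj, ofReal_norm]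

/-- The rotation acts by a unitary matrix and the sign has modulus one, so the norm is not random;
this makes the right spin computable. -/
theorem eLpNorm_sq_column_rotatedField (ω : SU2 × Bool) (t : Fin (n + 1)) :
    eLpNorm (column n t (rotatedField n y ω)) 2 vol ^ 2 = ‖y t‖ₑ ^ 2 := by
  rw [eLpNorm_sq_column]
  simp_rw [coeff_rotatedField, enorm_coeff_rotatedField]
  rw [← Finset.mul_sum, sum_enorm_sq_wignerD, mul_one]

theorem eLpNorm_sq_rotatedField (ω : SU2 × Bool) :
    eLpNorm (rotatedField n y ω) 2 vol ^ 2 = ∑ t, ‖y t‖ₑ ^ 2 := by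
  have he : Function.Injective fun i : Fin (n + 1) × Fin (n + 1) => (⟨n, i⟩ : HarmonicIndex) :=
    fun i j h => by simpa using h
  have h1 := eLpNorm_sq_sum he fun i => sign ω.2 * y i.2 * conj (wignerD n i.1 0 ω.1)
  rw [funext (rotatedField_eq n y ω)]
  refine h1.trans ?_
  simp_rw [enorm_coeff_rotatedField]
  rw [Fintype.sum_prod_type_right]
  simp_rw [← Finset.mul_sum, sum_enorm_sq_wignerD, mul_one]

theorem secondMoment_rotatedField :
    secondMoment rotationLaw (rotatedField n y) = ∑ t, ‖y t‖ₑ ^ 2 := by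
  rw [secondMoment]
  simp_rw [eLpNorm_sq_rotatedField]
  simp

theorem secondMoment_columns_rotatedField (t : Fin (n + 1)) :
    secondMoment rotationLaw (columns (rotatedField n y) ⟨n, t⟩) = ‖y t‖ₑ ^ 2 := by
  rw [secondMoment]
  simp only [columns, eLpNorm_sq_column_rotatedField]
  simp

theorem integral_haar_wignerD (k s : Fin (n + 1)) :
    ∫ z, wignerD n k 0 z * conj (wignerD n s 0 z) ∂haar = if s = k then 1 / (n + 1 : ℂ) else 0 := by
  have h1 := integral_wignerD n k 0 s 0
  rw [integral_vol] at h1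
  have hp : (Real.pi : ℂ) ≠ 0 := by exact_mod_cast Real.pi_ne_zero
  have h2 : ((16 * Real.pi ^ 2 : ℝ) : ℂ) ≠ 0 := by
    push_cast
    exact mul_ne_zero (by norm_num) (pow_ne_zero _ hp)
  apply mul_left_cancel₀ h2
  rw [h1]
  simp only [and_true]
  split_ifs
  · push_cast
    ring
  · simp

theorem exists_phi_ne_zero (s t : Fin (n + 1)) : ∃ z, phi n s t z ≠ 0 := by
  by_contra! h
  have h1 := coeff_phi n s t s t
  simp [coeff, h] at h1

/-- The columns of a rotated field with nonzero weights are correlated. -/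
theorem exists_cov_rotatedField_ne_zero (s s' : Fin (n + 1)) (hs : y s ≠ 0) (hs' : y s' ≠ 0) :
    ∃ g h, cov rotationLaw (fun ω => column n s (rotatedField n y ω) g)
      (fun ω => column n s' (rotatedField n y ω) h) ≠ 0 := by
  -- The covariance at `(1, z)` turns out to be a nonzero constant times `phi n s s' z`, whence this
  -- choice.
  obtain ⟨z, hz⟩ := exists_phi_ne_zero n s s'
  refine ⟨1, z, ?_⟩
  have hX := isSquareIntegrableField_rotatedField n y
  have hfin : ∀ t, secondMoment rotationLaw (columns (rotatedField n y) ⟨n, t⟩) < ∞ := fun t => by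
    rw [secondMoment_columns_rotatedField]
    exact ENNReal.pow_lt_top enorm_lt_top
  have hU := memLp_column hX (hfin s) 1
  have hV := memLp_column hX (hfin s') z
  simp only [columns] at hU hV
  rw [cov_eq hU hV]
  -- The independent sign centres the field; it matters for `n = 0`, where without it the field
  -- would be deterministic.
  have hmean : ∫ ω, column n s (rotatedField n y ω) 1 ∂rotationLaw = 0 := by
    simp only [column_rotatedField]
    have h1 := integral_prod_mul (μ := haar) (ν := coin)
      (fun h : SU2 => y s * phi n 0 s (h⁻¹ * 1)) sign
    rw [integral_sign, mul_zero] at h1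
    rw [← h1]
    exact integral_congr_ae (Eventually.of_forall fun ω => by ring)
  rw [hmean, map_zero, zero_mul, sub_zero]
  simp only [column_rotatedField]
  set c : ℂ := (Real.sqrt (n + 1) / (4 * Real.pi) : ℂ) with hc
  have h1 : ∀ ω : SU2 × Bool, conj (sign ω.2 * y s * phi n 0 s (ω.1⁻¹ * 1)) *
      (sign ω.2 * y s' * phi n 0 s' (ω.1⁻¹ * z)) =
      ∑ k, (conj c * conj (y s) * y s' * phi n k s' z) *
        (wignerD n s 0 ω.1 * conj (wignerD n k 0 ω.1)) := by
    intro ω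
    rw [mul_one, phi_mul, phi, ← hc, wignerD_inv, Finset.mul_sum, Finset.mul_sum]
    refine Finset.sum_congr rfl fun k _ => ?_
    rw [wignerD_inv]
    simp only [map_mul, conj_sign, Complex.conj_conj]
    linear_combination (conj c * conj (y s) * y s' * phi n k s' z *
      wignerD n s 0 ω.1 * conj (wignerD n k 0 ω.1)) * sign_mul_self ω.2
  have h2 : ∀ k, ∫ ω : SU2 × Bool, wignerD n s 0 ω.1 * conj (wignerD n k 0 ω.1) ∂rotationLaw =
      if k = s then 1 / (n + 1 : ℂ) else 0 := by
    intro k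
    rw [← integral_haar_wignerD]
    have := integral_fun_fst (μ := haar) (ν := coin)
      (fun h : SU2 => wignerD n s 0 h * conj (wignerD n k 0 h))
    refine this.trans ?_
    rw [probReal_univ, one_smul]
  have h3 : ∀ k, Integrable (fun ω : SU2 × Bool => (conj c * conj (y s) * y s' * phi n k s' z) *
        (wignerD n s 0 ω.1 * conj (wignerD n k 0 ω.1))) rotationLaw := by
    intro k
    refine Integrable.const_mul ?_ _
    have : Continuous fun ω : SU2 × Bool => wignerD n s 0 ω.1 * conj (wignerD n k 0 ω.1) :=
      ((continuous_wignerD n s 0).comp continuous_fst).mul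
        (Complex.continuous_conj.comp ((continuous_wignerD n k 0).comp continuous_fst))
    exact this.integrable_of_hasCompactSupport (HasCompactSupport.of_compactSpace _)
  simp_rw [h1]
  rw [integral_finsetSum _ fun k _ => h3 k]
  simp_rw [integral_const_mul, h2]
  simp only [mul_ite, mul_zero, Finset.sum_ite_eq', Finset.mem_univ, if_true]
  have hc0 : c ≠ 0 := by
    intro h0
    rw [phi, ← hc, h0, zero_mul] at hz
    exact hz rfl
  simp [hc0, hs, hs', hz]
  exact_mod_cast n.succ_ne_zero

/-! ### The expected right spin of rotated fields -/

theorem injective_spin : Function.Injective (spin n) := by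
  intro i j h
  have h1 : ((i : ℕ) : ℚ) = ((j : ℕ) : ℚ) := sub_left_inj.mp h
  exact Fin.ext (by exact_mod_cast h1)

/-- The normalization makes every denominator `1`, and columns of other degrees vanish, so the
weight at each spin is the squared modulus of its `y t`. -/
theorem expectedRightSpin_rotatedField (hy : ∑ t, ‖y t‖ₑ ^ 2 = 1) (A : Set ℚ) :
    expectedRightSpin rotationLaw (rotatedField n y) A =
      ∑ t, ‖y t‖ₑ ^ 2 * Measure.dirac (spin n t) A := by
  rw [expectedRightSpin, Measure.sum_apply _ (Set.to_countable A).measurableSet]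
  simp_rw [eLpNorm_sq_rotatedField, hy]
  refine Eq.trans ?_ (tsum_fintype (L := .unconditional _) _)
  have hinj : Function.Injective fun t : Fin (n + 1) => (⟨n, t⟩ : Σ n : ℕ, Fin (n + 1)) :=
    fun t t' h => by simpa using h
  rw [← hinj.tsum_eq]
  · refine tsum_congr fun t => ?_
    simp only [columns, eLpNorm_sq_column_rotatedField, Measure.smul_apply, smul_eq_mul]
    simp
  · rintro ⟨n', t⟩ h
    by_cases hn : n' = n
    · subst hn
      exact ⟨t, rfl⟩
    · refine absurd ?_ h
      have h0 : ∀ ω, eLpNorm (columns (rotatedField n y) ⟨n', t⟩ ω) 2 vol ^ 2 = 0 := by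
        intro ω
        simp only [columns]
        rw [eLpNorm_sq_column]
        simp [coeff_rotatedField_of_ne n y hn]
      simp [h0]

theorem apply_eq_sum_spin (ν : Measure ℚ) [IsProbabilityMeasure ν]
    (hν : ν (Set.range (spin n)) = 1) (A : Set ℚ) :
    ν A = ∑ t, ν {spin n t} * Measure.dirac (spin n t) A := by
  have h1 : ∀ q ∉ Set.range (spin n), ν {q} = 0 := by
    intro q hq
    have h2 : ν (Set.range (spin n))ᶜ = 0 :=
      (prob_compl_eq_zero_iff (Set.to_countable _).measurableSet).mpr hν
    exact measure_mono_null (Set.singleton_subset_iff.mpr hq) h2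
  conv_lhs => rw [← Measure.sum_smul_dirac ν]
  rw [Measure.sum_apply _ (Set.to_countable A).measurableSet]
  refine Eq.trans ?_ (tsum_fintype (L := .unconditional _) _)
  rw [← (injective_spin n).tsum_eq]
  · rfl
  · intro q hq
    by_contra hq'
    exact hq (by simp [h1 q hq'])

theorem exists_expectedRightSpin_eq (ν : Measure ℚ) [IsProbabilityMeasure ν]
    (hν : ν (Set.range (spin n)) = 1) :
    ∃ y : Fin (n + 1) → ℂ, expectedRightSpin rotationLaw (rotatedField n y) = ν := by
  refine ⟨fun t => (Real.sqrt (ν.real {spin n t}) : ℂ), ?_⟩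
  have h1 : ∀ t, ‖(Real.sqrt (ν.real {spin n t}) : ℂ)‖ₑ ^ 2 = ν {spin n t} := by
    intro t
    rw [← ofReal_norm, ← ENNReal.ofReal_pow (norm_nonneg _), Complex.norm_real, Real.norm_eq_abs,
      sq_abs, Real.sq_sqrt measureReal_nonneg]
    exact ofReal_measureReal
  have h2 : ∑ t, ν {spin n t} = 1 := by
    have := apply_eq_sum_spin n ν hν Set.univ
    simpa using this.symm
  ext A -
  rw [expectedRightSpin_rotatedField n _ (by simp_rw [h1, h2]), apply_eq_sum_spin n ν hν A]
  simp_rw [h1]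

end

end

end SpinField

open SpinField
theorem mainTheorem2 {Ω : Type*} [MeasurableSpace Ω] (P : Measure Ω) [IsProbabilityMeasure P]
    (X : Ω → SU2 → ℂ) (hX : IsSquareIntegrableField P X) :
    -- left-invariance of the field and joint left-invariance of its column components
    (LeftInvariant P X ↔ JointlyLeftInvariant P (columns X)) ∧
    -- the same for left-invariance of the finite-dimensional distributions of the field
    (PointwiseLeftInvariant P X → JointlyLeftInvariant P (columns X)) ∧
    (ContinuousInProbability P X → JointlyLeftInvariant P (columns X) →
      PointwiseLeftInvariant P X) ∧
    -- the correlation structure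
    (LeftInvariant P X →
      ∀ (n : ℕ) (s : Fin (n + 1)), secondMoment P (columns X ⟨n, s⟩) < ∞ →
        (n ≠ 0 → ∀ m, ∫ ω, coeff n m s (X ω) ∂P = 0) ∧
        (∀ m, ∫ ω, ‖coeff n m s (X ω)‖ ^ 2 ∂P =
          (1 / (n + 1 : ℝ)) * ∫ ω, ∫ g, ‖column n s (X ω) g‖ ^ 2 ∂vol ∂P) ∧
        (∀ s' : Fin (n + 1), secondMoment P (columns X ⟨n, s'⟩) < ∞ → ∀ m m' : Fin (n + 1),
          ∫ ω, conj (coeff n m s (X ω)) * coeff n m' s' (X ω) ∂P =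
            (if m' = m then 1 / (n + 1 : ℂ) else 0) *
              ∑ k, ∫ ω, conj (coeff n k s (X ω)) * coeff n k s' (X ω) ∂P ∧
          ∫ ω, coeff n m s (X ω) * coeff n m' s' (X ω) ∂P =
            (if m' = m.rev then (-1) ^ (n - m : ℕ) / (n + 1 : ℂ) else 0) *
              ∑ k : Fin (n + 1), (-1) ^ (n - k : ℕ) *
                ∫ ω, coeff n k s (X ω) * coeff n k.rev s' (X ω) ∂P) ∧
        (∀ (n' : ℕ) (s' : Fin (n' + 1)), n' ≠ n → secondMoment P (columns X ⟨n', s'⟩) < ∞ →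
          (∀ m m',
            ∫ ω, conj (coeff n m s (X ω)) * coeff n' m' s' (X ω) ∂P = 0 ∧
            ∫ ω, coeff n m s (X ω) * coeff n' m' s' (X ω) ∂P = 0) ∧
          Uncorrelated P (columns X ⟨n, s⟩) (columns X ⟨n', s'⟩))) ∧
    -- column components of the same degree can be correlated
    (∀ (n : ℕ) (s s' : Fin (n + 1)),
      ∃ (Ω' : Type) (_ : MeasurableSpace Ω') (P' : Measure Ω') (Y : Ω' → SU2 → ℂ),
        IsProbabilityMeasure P' ∧ IsSquareIntegrableField P' Y ∧ secondMoment P' Y < ∞ ∧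
        LeftInvariant P' Y ∧ PointwiseLeftInvariant P' Y ∧
        (∀ ω, Y ω = degreePart n (Y ω)) ∧
        ∃ g h, cov P' (fun ω => column n s (Y ω) g) (fun ω => column n s' (Y ω) h) ≠ 0) ∧
    -- every probability on `{-ℓ, …, ℓ}` is the expected right spin of a left-invariant field
    (∀ (n : ℕ) (ν : Measure ℚ), IsProbabilityMeasure ν → ν (Set.range (spin n)) = 1 →
      ∃ (Ω' : Type) (_ : MeasurableSpace Ω') (P' : Measure Ω') (Y : Ω' → SU2 → ℂ),
        IsProbabilityMeasure P' ∧ IsSquareIntegrableField P' Y ∧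
        LeftInvariant P' Y ∧ PointwiseLeftInvariant P' Y ∧
        (∀ ω, Y ω = degreePart n (Y ω)) ∧
        expectedRightSpin P' Y = ν) := by
  -- All forms of invariance are compared through the law of the coefficients.
  have hJ : JointlyLeftInvariant P (columns X) ↔ CoeffInvariant P X :=
    ⟨coeffInvariant_of_columns hX, fun h => h.jointlyLeftInvariant_columns hX⟩
  refine ⟨?_, fun h => hJ.mpr (h.coeffInvariant hX),
    fun hc h => (hJ.mp h).pointwiseLeftInvariant hX hc, ?_, ?_, ?_⟩
  · rw [hJ]
    exact ⟨fun h => h.coeffInvariant hX, fun h => h.leftInvariant hX⟩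
  · intro h n s hs
    have hc := h.coeffInvariant hX
    refine ⟨fun hn m => hc.integral_coeff_eq_zero hX hn hs m,
      fun m => hc.integral_norm_sq hX hs m,
      fun s' hs' m m' => ⟨hc.integral_conj_mul hX hs hs' m m', hc.integral_mul hX hs hs' m m'⟩,
      fun n' s' hn hs' => ⟨fun m m' => ⟨hc.integral_conj_mul_of_ne hX hn.symm hs hs' m m',
        hc.integral_mul_of_ne hX hn.symm hs hs' m m'⟩, hc.uncorrelated hX hn.symm hs hs'⟩⟩
  · intro n s s'
    -- Constant weights make every column nonzero, so a single field serves all pairs `s, s'`.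
    refine ⟨SU2 × Bool, inferInstance, rotationLaw, rotatedField n fun _ => 1, inferInstance,
      isSquareIntegrableField_rotatedField n _, ?_, leftInvariant_rotatedField n _,
      pointwiseLeftInvariant_rotatedField n _, rotatedField_eq_degreePart n _,
      exists_cov_rotatedField_ne_zero n _ s s' one_ne_zero one_ne_zero⟩
    rw [secondMoment_rotatedField]
    exact ENNReal.sum_lt_top.mpr fun _ _ => ENNReal.pow_lt_top enorm_lt_top
  · intro n ν hν hr
    obtain ⟨y, hy⟩ := exists_expectedRightSpin_eq n ν hr
    exact ⟨SU2 × Bool, inferInstance, rotationLaw, rotatedField n y, inferInstance,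
      isSquareIntegrableField_rotatedField n y, leftInvariant_rotatedField n y,
      pointwiseLeftInvariant_rotatedField n y, rotatedField_eq_degreePart n y, hy⟩
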